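/- Let $n\ge d\ge 2$ be integers. For a $d$-dimensional convex polytope $P$ and $S\subseteq\{0,1,\dots,d-1\}$, an $S$-flag of $P$ is a chain $\emptyset\subsetneq F_1\subsetneq\cdots\subsetneq F_r\subsetneq P$ of faces of $P$ with $\{\dim F_1,\dots,\dim F_r\}=S$; let $f_S(P)$ be the number of $S$-flags of $P$. The vector $(f_S(P))_{S\subseteq\{0,\dots,d-1\}}$ is the flag vector of $P$. A $d$-dimensional multiplex with $n+1$ vertices, denoted $M^{d,n}$, is a $d$-dimensional convex polytope with an ordered list of distinct vertices $x_0,x_1,\dots,x_n$ whose facets are exactly $$F_i=\operatorname{conv}\{x_{i-d+1},x_{i-d+2},\dots,x_{i-1},x_{i+1},x_{i+2},\dots,x_{i+d-1}\},\qquad 0\le i\le n,$$ with the conventions that $x_j=x_0$ if $j<0$ and $x_j=x_n$ if $j>n$. Theorem. Every multiplex $M^{d,n}$ has the same flag vector as every $(d-2)$-fold pyramid over a convex $(n-d+3)$-gon. For $S=\{s_1<s_2<\cdots<s_r\}\subseteq\{0,1,\dots,d-1\}$, with $s_{r+1}=d$, the common flag vector is given by $$f_S=\binom{d+1}{s_1+1,\;s_2-s_1,\;\dots,\;s_r-s_{r-1},\;d-s_r}\left[1+\frac{n-d}{(d+1)d(d-1)}\sum_{j=1}^{r}(s_j+1)(s_{j+1}-s_j)(s_{j+1}-1)\right],$$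 where for $S=\emptyset$ the multinomial coefficient and hence $f_\emptyset$ equal $1$. -/

import Mathlib

/-- The dimension of a (nonempty) subset of a real vector space: the dimension of its affine
hull. -/
noncomputable def convexDim {E : Type*} [NormedAddCommGroup E] [NormedSpace ℝ E]
    (F : Set E) : ℕ :=
  Module.finrank ℝ (vectorSpan ℝ F)

/-- `F` is a proper nonempty face of the polytope `P`: a nonempty subset of `P`, different from
`P`, on which some linear functional attains its maximum over `P`. -/
def IsProperFace {E : Type*} [NormedAddCommGroup E] [NormedSpace ℝ E]
    (P F : Set E) : Prop :=
  IsExposed ℝ P F ∧ F.Nonempty ∧ F ≠ P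

/-- A facet: a proper nonempty face of codimension one. -/
def IsFacet {E : Type*} [NormedAddCommGroup E] [NormedSpace ℝ E]
    (P F : Set E) : Prop :=
  IsProperFace P F ∧ convexDim F + 1 = convexDim P

/-- `C` is an `S`-flag of `P`: a chain of faces, strictly between `∅` and `P`, whose set of
dimensions is `S`. -/
def IsFlag {E : Type*} [NormedAddCommGroup E] [NormedSpace ℝ E]
    (P : Set E) (S : Set ℕ) (C : Set (Set E)) : Prop :=
  (∀ F ∈ C, IsProperFace P F) ∧ IsChain (· ⊆ ·) C ∧ convexDim '' C = S

/-- The flag vector `(f_S(P))`, `S ⊆ {0, …, d - 1}`, of a `d`-dimensional polytope `P`. -/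
noncomputable def flagVector {E : Type*} [NormedAddCommGroup E] [NormedSpace ℝ E]
    (d : ℕ) (P : Set E) (S : Finset (Fin d)) : ℕ :=
  {C : Set (Set E) | IsFlag P ((fun k : Fin d => (k : ℕ)) '' (S : Set (Fin d))) C}.ncard

/-- The index convention for vertex lists `x_0, …, x_n`: `x_j = x_0` for `j < 0` and
`x_j = x_n` for `j > n`. -/
def clampIndex (n : ℕ) (j : ℤ) : Fin (n + 1) :=
  ⟨(min j n).toNat, by omega⟩

/-- `F_i = conv {x_{i-d+1}, …, x_{i-1}, x_{i+1}, …, x_{i+d-1}}`. -/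
def multiplexFacet {E : Type*} [NormedAddCommGroup E] [NormedSpace ℝ E]
    (d : ℕ) {n : ℕ} (x : Fin (n + 1) → E) (i : Fin (n + 1)) : Set E :=
  convexHull ℝ ((fun j : ℤ => x (clampIndex n j)) ''
    {j : ℤ | (i : ℤ) - d + 1 ≤ j ∧ j ≤ (i : ℤ) + d - 1 ∧ j ≠ (i : ℤ)})

/-- `P` is a `d`-dimensional multiplex with the ordered list of (distinct) vertices
`x_0, …, x_n`. -/
structure IsMultiplex {E : Type*} [NormedAddCommGroup E] [NormedSpace ℝ E]
    (d : ℕ) {n : ℕ} (x : Fin (n + 1) → E) (P : Set E) : Prop where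
  eq_convexHull : P = convexHull ℝ (Set.range x)
  injective : Function.Injective x
  vertices : P.extremePoints ℝ = Set.range x
  dim : convexDim P = d
  facets : {F : Set E | IsFacet P F} = Set.range (multiplexFacet d x)

/-- `G` is a (convex) `m`-gon: a two-dimensional polytope with exactly `m` vertices. -/
def IsPolygon {E : Type*} [NormedAddCommGroup E] [NormedSpace ℝ E]
    (m : ℕ) (G : Set E) : Prop :=
  ∃ V : Finset E, V.card = m ∧ G = convexHull ℝ (V : Set E) ∧
    G.extremePoints ℝ = (V : Set E) ∧ convexDim G = 2

/-- `Q` is a `k`-fold pyramid over `B`. -/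
def IsIteratedPyramid {E : Type*} [NormedAddCommGroup E] [NormedSpace ℝ E]
    (B : Set E) : ℕ → Set E → Prop
  | 0, Q => Q = B
  | k + 1, Q => ∃ (B' : Set E) (a : E), IsIteratedPyramid B k B' ∧
      a ∉ affineSpan ℝ B' ∧ Q = convexHull ℝ (insert a B')

/-- For `S = {s_1 < … < s_r}` the sequence `s_1, …, s_r, s_{r+1} = d` (indexed from `0`). -/
def extendedSeq {d r : ℕ} (s : Fin r → Fin d) : Fin (r + 1) → ℕ :=
  Fin.snoc (α := fun _ => ℕ) (fun j => (s j : ℕ)) d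

/-- The parts `s_1 + 1, s_2 - s_1, …, s_r - s_{r-1}, d - s_r`, which sum to `d + 1`
(for `r = 0` the single part `d + 1`). -/
def flagParts {d r : ℕ} (s : Fin r → Fin d) : Fin (r + 1) → ℕ :=
  Fin.cons (α := fun _ => ℕ) (extendedSeq s 0 + 1)
    (fun j : Fin r => extendedSeq s j.succ - extendedSeq s j.castSucc)

/-- The closed formula for the entry `f_S`, `S = {s_1 < … < s_r} ⊆ {0, …, d - 1}`. -/
def flagFormula (d n : ℕ) {r : ℕ} (s : Fin r → Fin d) : ℚ :=
  (Nat.multinomial Finset.univ (flagParts s) : ℚ) *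
    (1 + ((n : ℚ) - d) / (((d : ℚ) + 1) * d * ((d : ℚ) - 1)) *
      ∑ j : Fin r, ((extendedSeq s j.castSucc : ℚ) + 1) *
        ((extendedSeq s j.succ : ℚ) - extendedSeq s j.castSucc) *
        ((extendedSeq s j.succ : ℚ) - 1))

/-!
The flag vector of a polytope is governed by its face lattice, and the flag numbers obey the
recursion that a flag with largest member `G` is a flag of the polytope `G` together with `G`.
Call the number of vertices of a `k`-dimensional face minus `k + 1` its *excess*. The closed formula
for a face is affine in its excess, so the recursion closes up once two numbers are known for every
face and every `k`: the number of its `k`-dimensional faces and the total excess of these. The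
structure `FaceSystem.HasPyramidCounts` records the values that occur for iterated pyramids over
polygons, and `FaceSystem.HasPyramidCounts.card_flagsBelow` deduces the formula from them. The two
families of polytopes are then treated alike: both satisfy `HasPyramidCounts`.

Faces of `convexHull V` are encoded by their points in `V`, that is, as zero sets on `V` of affine
functionals that are nonnegative on `V` (`IsVertexFace`). Tilting such a functional shows that a
face and a point outside it are separated by a facet (`IsVertexFace.exists_facet`), and that at most
two faces lie strictly between faces whose dimensions differ by two
(`IsVertexFace.not_three_between`). The second fact gives the face counts of polygons, and the faces
of a pyramid are the faces of the base with or without the apex, so that the counts of iterated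
pyramids are Pascal sums (`hasPyramidCounts_insert`).

For a multiplex, vertex `v` lies on facet `i` exactly if `|v - i| < d` and `v ≠ i`, except that the
first and the last vertex lie on the facets with the same index. The facets of a facet are the
maximal intersections with other facets, and computing these shows that the facets of a multiplex,
hence all its faces, are again multiplexes (`IsMultiplexFace.facet`). Sorting the faces by the last
facet containing them gives a recursion in the dimension for their number
(`IsMultiplexFace.card_last_facet`, `IsMultiplexFace.card_below`). The incidence relation is
symmetric, so a multiplex is self-dual, and the faces through a vertex `v` correspond to the faces
of complementary dimension in the facet `v` (`IsMultiplexFace.card_below_filter_mem`). This yields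
the number of incidences of vertices and faces and with it the total excess.
-/

/-! ### Faces of a polytope as zero sets on its vertices -/

section VertexFaces

open scoped Classical

variable {E : Type*} [NormedAddCommGroup E] [NormedSpace ℝ E]

/-- The homogenization of a point: affine functionals on `E` are the linear functionals on `E × ℝ`
evaluated at homogenized points. -/
def homogenize (v : E) : E × ℝ := (v, 1)

/-- `F` is the set of points of `V` lying on a face of `convexHull V`: the zero set on `V` of an
affine functional that is nonnegative on `V`. Both `∅` and `V` are allowed. -/
def IsVertexFace (V F : Finset E) : Prop :=
  F ⊆ V ∧ ∃ f : Module.Dual ℝ (E × ℝ),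
    (∀ v ∈ V, 0 ≤ f (homogenize v)) ∧ ∀ v ∈ V, f (homogenize v) = 0 ↔ v ∈ F

/-- The linear span of the homogenized points of `F`. -/
def homSpan (F : Finset E) : Submodule ℝ (E × ℝ) :=
  Submodule.span ℝ (homogenize '' (F : Set E))

/-- The dimension of `homSpan F`: one more than the dimension of the affine hull of `F`, and `0`
for `F = ∅`. -/
noncomputable def vertexRank (F : Finset E) : ℕ := Module.finrank ℝ (homSpan F)

lemma homogenize_mem_homSpan {F : Finset E} {v : E} (hv : v ∈ F) : homogenize v ∈ homSpan F :=
  Submodule.subset_span ⟨v, hv, rfl⟩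

lemma homSpan_le_ker {F : Finset E} {f : Module.Dual ℝ (E × ℝ)}
    (h : ∀ v ∈ F, f (homogenize v) = 0) : homSpan F ≤ LinearMap.ker f := by
  rw [homSpan, Submodule.span_le]
  rintro _ ⟨v, hv, rfl⟩
  exact h v hv

lemma homSpan_le_iff {F : Finset E} {U : Submodule ℝ (E × ℝ)} :
    homSpan F ≤ U ↔ ∀ v ∈ F, homogenize v ∈ U := by
  rw [homSpan, Submodule.span_le]
  exact Set.image_subset_iff

lemma homSpan_mono {F G : Finset E} (h : G ⊆ F) : homSpan G ≤ homSpan F :=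
  homSpan_le_iff.2 fun _ hv => homogenize_mem_homSpan (h hv)

instance (F : Finset E) : FiniteDimensional ℝ (homSpan F) :=
  FiniteDimensional.span_of_finite ℝ (F.finite_toSet.image _)

@[simp] lemma vertexRank_empty : vertexRank (∅ : Finset E) = 0 := by
  rw [vertexRank, homSpan, Finset.coe_empty, Set.image_empty, Submodule.span_empty, finrank_bot]

lemma homSpan_insert (v : E) (F : Finset E) :
    homSpan (insert v F) = Submodule.span ℝ {homogenize v} ⊔ homSpan F := by
  rw [homSpan, homSpan, Finset.coe_insert, Set.image_insert_eq, Submodule.span_insert]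

lemma vertexRank_insert_le (v : E) (F : Finset E) :
    vertexRank (insert v F) ≤ vertexRank F + 1 := by
  rw [vertexRank, homSpan_insert]
  have h1 := Submodule.finrank_add_le_finrank_add_finrank
    (Submodule.span ℝ {homogenize v}) (homSpan F)
  have h2 : Module.finrank ℝ (Submodule.span ℝ {homogenize v}) ≤ 1 := by
    simpa using finrank_span_le_card (R := ℝ) ({homogenize v} : Set (E × ℝ))
  unfold vertexRank
  omega

lemma vertexRank_le_card (F : Finset E) : vertexRank F ≤ F.card := by
  induction F using Finset.induction_on with
  | empty => simp
  | insert v F hv ih =>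
    rw [Finset.card_insert_of_notMem hv]
    exact (vertexRank_insert_le v F).trans (by omega)

lemma isVertexFace_empty (V : Finset E) : IsVertexFace V ∅ :=
  ⟨by simp, LinearMap.snd ℝ E ℝ, by simp [homogenize], by simp [homogenize]⟩

lemma isVertexFace_self (V : Finset E) : IsVertexFace V V :=
  ⟨subset_rfl, 0, by simp, by simp⟩

lemma IsVertexFace.inter {V F G : Finset E} (hF : IsVertexFace V F) (hG : IsVertexFace V G) :
    IsVertexFace V (F ∩ G) := by
  obtain ⟨hFV, f, hf, hf0⟩ := hF
  obtain ⟨hGV, g, hg, hg0⟩ := hG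
  refine ⟨Finset.inter_subset_left.trans hFV, f + g, fun v hv => ?_, fun v hv => ?_⟩
  · have := hf v hv; have := hg v hv
    simp only [LinearMap.add_apply]; linarith
  · have h1 := hf v hv
    have h2 := hg v hv
    rw [Finset.mem_inter, ← hf0 v hv, ← hg0 v hv, LinearMap.add_apply]
    constructor
    · intro h; constructor <;> linarith
    · rintro ⟨h, h'⟩; linarith

lemma IsVertexFace.vertexRank_lt {V F G : Finset E} (hG : IsVertexFace V G) (hF : F ⊆ V)
    (hGF : G ⊂ F) : vertexRank G < vertexRank F := by
  obtain ⟨-, f, -, hf0⟩ := hG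
  obtain ⟨v, hv, hvG⟩ := Finset.exists_of_ssubset hGF
  refine Submodule.finrank_lt_finrank_of_lt (lt_of_le_of_ne (homSpan_mono hGF.1) fun h => hvG ?_)
  have h1 : homogenize v ∈ homSpan G := h ▸ homogenize_mem_homSpan hv
  have h2 := homSpan_le_ker (fun w hw => (hf0 w (hF (hGF.1 hw))).2 hw) h1
  exact (hf0 v (hF hv)).1 h2

/-- A face of a face is a face: a functional that is nonnegative on `F` only becomes nonnegative
on `V` after adding a large multiple of the functional that cuts out `F`. -/
lemma IsVertexFace.zeroSet {V F : Finset E} (hF : IsVertexFace V F) (g : Module.Dual ℝ (E × ℝ))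
    (hg : ∀ v ∈ F, 0 ≤ g (homogenize v)) :
    IsVertexFace V (F.filter fun v => g (homogenize v) = 0) := by
  obtain ⟨hFV, f, hf, hf0⟩ := hF
  obtain ⟨N, hN⟩ := Finset.exists_le (V.image fun v => -g (homogenize v) / f (homogenize v))
  have key : ∀ v ∈ V, v ∉ F → 0 < (g + (N + 1) • f) (homogenize v) := by
    intro v hv hvF
    have h1 : 0 < f (homogenize v) :=
      lt_of_le_of_ne (hf v hv) fun h => hvF ((hf0 v hv).1 h.symm)
    have h2 := hN _ (Finset.mem_image_of_mem _ hv)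
    rw [div_le_iff₀ h1] at h2
    simp only [LinearMap.add_apply, LinearMap.smul_apply, smul_eq_mul]
    linarith
  refine ⟨(Finset.filter_subset _ _).trans hFV, g + (N + 1) • f, fun v hv => ?_, fun v hv => ?_⟩
  · by_cases hvF : v ∈ F
    · simpa [(hf0 v hv).2 hvF] using hg v hvF
    · exact (key v hv hvF).le
  · by_cases hvF : v ∈ F
    · simp [(hf0 v hv).2 hvF, hvF]
    · simp only [(key v hv hvF).ne', Finset.mem_filter, hvF, false_and]

/-- If a face `G` of `F` is not a facet of `F`, then there is a further face between them, and it
can be chosen to avoid any prescribed point `v` of `F` outside `G`. A functional `f` cutting out `G`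
is tilted by a functional `g` vanishing on `G` and at `v` until it vanishes at a further point. -/
lemma IsVertexFace.exists_between {V F G : Finset E} (hF : IsVertexFace V F)
    (hG : IsVertexFace V G) (hGF : G ⊆ F) {v : E} (hv : v ∈ F) (hvG : v ∉ G)
    (hrk : vertexRank G + 2 ≤ vertexRank F) :
    ∃ H, IsVertexFace V H ∧ G ⊂ H ∧ H ⊆ F ∧ v ∉ H := by
  have hFV := hF.1
  obtain ⟨hGV, f, hf, hf0⟩ := hG
  obtain ⟨w, hwF, hw⟩ : ∃ w ∈ F, homogenize w ∉ homSpan (insert v G) := by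
    by_contra! h
    have h1 := Submodule.finrank_mono (homSpan_le_iff.2 h)
    have h2 := vertexRank_insert_le v G
    unfold vertexRank at *
    omega
  obtain ⟨g, hgw, hg0⟩ : ∃ g : Module.Dual ℝ (E × ℝ), 0 < g (homogenize w) ∧
      ∀ u ∈ insert v G, g (homogenize u) = 0 := by
    obtain ⟨g, hgw, hg⟩ := Submodule.exists_le_ker_of_notMem hw
    have hg0 : ∀ u ∈ insert v G, g (homogenize u) = 0 := fun u hu =>
      hg (homogenize_mem_homSpan hu)
    rcases lt_or_gt_of_ne hgw with h | h
    · exact ⟨-g, by simpa using h, fun u hu => by simp [hg0 u hu]⟩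
    · exact ⟨g, h, hg0⟩
  obtain ⟨w₀, hw₀, hmin⟩ := Finset.exists_min_image (F.filter fun u => 0 < g (homogenize u))
    (fun u => f (homogenize u) / g (homogenize u)) ⟨w, by simp [hwF, hgw]⟩
  rw [Finset.mem_filter] at hw₀
  set t := f (homogenize w₀) / g (homogenize w₀) with ht
  have ht0 : 0 ≤ t := div_nonneg (hf _ (hFV hw₀.1)) hw₀.2.le
  refine ⟨F.filter fun u => (f - t • g) (homogenize u) = 0, hF.zeroSet _ fun u hu => ?_, ?_,
    Finset.filter_subset _ _, ?_⟩
  · simp only [LinearMap.sub_apply, LinearMap.smul_apply, smul_eq_mul]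
    have h1 := hf u (hFV hu)
    rcases le_or_gt (g (homogenize u)) 0 with h | h
    · nlinarith
    · have h2 := hmin u (by simp [hu, h])
      rw [le_div_iff₀ h] at h2
      linarith
  · refine Finset.ssubset_iff_subset_ne.2 ⟨fun u hu => ?_, fun h => ?_⟩
    · simp [hGF hu, (hf0 u (hGV hu)).2 hu, hg0 u (Finset.mem_insert_of_mem hu)]
    · have h1 : w₀ ∈ G := by
        rw [h, Finset.mem_filter]
        refine ⟨hw₀.1, ?_⟩
        simp only [LinearMap.sub_apply, LinearMap.smul_apply, smul_eq_mul, ht]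
        rw [div_mul_cancel₀ _ hw₀.2.ne', sub_self]
      exact hw₀.2.ne' (hg0 _ (Finset.mem_insert_of_mem h1))
  · simp only [Finset.mem_filter, LinearMap.sub_apply, LinearMap.smul_apply, smul_eq_mul,
      hg0 v (Finset.mem_insert_self _ _), mul_zero, sub_zero, not_and]
    exact fun _ h => hvG ((hf0 v (hFV hv)).1 h)

/-- A face `G` of a face `F` and a point of `F` outside `G` are separated by a facet of `F`. -/
lemma IsVertexFace.exists_facet {V F G : Finset E} (hF : IsVertexFace V F)
    (hG : IsVertexFace V G) (hGF : G ⊆ F) {v : E} (hv : v ∈ F) (hvG : v ∉ G) :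
    ∃ H, IsVertexFace V H ∧ G ⊆ H ∧ H ⊆ F ∧ v ∉ H ∧ vertexRank H + 1 = vertexRank F := by
  obtain ⟨H, hH, hmax⟩ := Finset.exists_max_image
    (F.powerset.filter fun H => IsVertexFace V H ∧ G ⊆ H ∧ v ∉ H) Finset.card
    ⟨G, by simp [hGF, hG, hvG]⟩
  simp only [Finset.mem_filter, Finset.mem_powerset] at hH hmax
  obtain ⟨hHF, hH, hGH, hvH⟩ := hH
  refine ⟨H, hH, hGH, hHF, hvH, ?_⟩
  have h1 : vertexRank H < vertexRank F := hH.vertexRank_lt hF.1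
    (Finset.ssubset_iff_subset_ne.2 ⟨hHF, fun h => hvH (h ▸ hv)⟩)
  by_contra h2
  obtain ⟨K, hK, hHK, hKF, hvK⟩ := hF.exists_between hH hHF hv hvH (by omega)
  exact absurd (Finset.card_lt_card hHK) (hmax K ⟨hKF, hK, hGH.trans hHK.1, hvK⟩).not_gt

/-- Distinct faces strictly between `G` and `F` meet in `G` when the ranks of `G` and `F` differ by
two. -/
lemma IsVertexFace.mem_of_mem_between {V F G A B : Finset E} (hFV : F ⊆ V)
    (hG : IsVertexFace V G) (hrk : vertexRank F = vertexRank G + 2)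
    (hA : IsVertexFace V A) (hB : IsVertexFace V B)
    (hGA : G ⊂ A) (hGB : G ⊂ B) (hAF : A ⊂ F) (hBF : B ⊂ F) (hAB : A ≠ B) {v : E}
    (hvA : v ∈ A) (hvB : v ∈ B) : v ∈ G := by
  by_contra hvG
  have hG' : G ⊂ A ∩ B := Finset.ssubset_iff_subset_ne.2
    ⟨Finset.subset_inter hGA.1 hGB.1, fun h => hvG (h ▸ Finset.mem_inter.2 ⟨hvA, hvB⟩)⟩
  have r1 := hG.vertexRank_lt (hA.inter hB).1 hG'
  have r2 := hA.vertexRank_lt hFV hAF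
  have r3 := hB.vertexRank_lt hFV hBF
  have e1 : A ∩ B = A := by
    by_contra hne
    have := (hA.inter hB).vertexRank_lt hA.1
      (Finset.ssubset_iff_subset_ne.2 ⟨Finset.inter_subset_left, hne⟩)
    omega
  have e2 : A ∩ B = B := by
    by_contra hne
    have := (hA.inter hB).vertexRank_lt hB.1
      (Finset.ssubset_iff_subset_ne.2 ⟨Finset.inter_subset_right, hne⟩)
    omega
  exact hAB (e1.symm.trans e2)

lemma homSpan_lt_insert {G : Finset E} {v : E} {f : Module.Dual ℝ (E × ℝ)}
    (hf : ∀ w ∈ G, f (homogenize w) = 0) (hv : f (homogenize v) ≠ 0) :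
    homSpan G < homSpan (insert v G) :=
  lt_of_le_of_ne (homSpan_mono (Finset.subset_insert _ _)) fun h => hv
    (homSpan_le_ker hf (h ▸ homogenize_mem_homSpan (Finset.mem_insert_self v G)))

lemma exists_eval_eq_of_homSpan_insert {F G : Finset E} {v₁ v₂ v₃ : E}
    (hspan : homSpan (insert v₁ (insert v₂ G)) = homSpan F) (hv₃ : v₃ ∈ F) :
    ∃ a b : ℝ, ∀ g : Module.Dual ℝ (E × ℝ), (∀ w ∈ G, g (homogenize w) = 0) →
      g (homogenize v₃) = a * g (homogenize v₁) + b * g (homogenize v₂) := by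
  have hmem : homogenize v₃ ∈ homSpan (insert v₁ (insert v₂ G)) :=
    hspan.symm.le (homogenize_mem_homSpan hv₃)
  rw [homSpan_insert, homSpan_insert, Submodule.mem_sup] at hmem
  obtain ⟨p, h1, q, h2, hsum⟩ := hmem
  obtain ⟨r, h2, y, hy, hq⟩ := Submodule.mem_sup.1 h2
  obtain ⟨a, ha⟩ := Submodule.mem_span_singleton.1 h1
  obtain ⟨b, hb⟩ := Submodule.mem_span_singleton.1 h2
  refine ⟨a, b, fun g hg => ?_⟩
  have h0 : g y = 0 := homSpan_le_ker hg hy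
  rw [← hsum, ← hq, ← ha, ← hb, map_add, map_add, map_smul, map_smul, h0, add_zero,
    smul_eq_mul, smul_eq_mul]

/-- At most two faces lie strictly between faces whose ranks differ by two. -/
lemma IsVertexFace.not_three_between {V F G : Finset E} (hF : IsVertexFace V F)
    (hG : IsVertexFace V G) (hrk : vertexRank F = vertexRank G + 2) {H₁ H₂ H₃ : Finset E}
    (h₁ : IsVertexFace V H₁) (h₂ : IsVertexFace V H₂) (h₃ : IsVertexFace V H₃)
    (hG₁ : G ⊂ H₁) (hG₂ : G ⊂ H₂) (hG₃ : G ⊂ H₃) (hF₁ : H₁ ⊂ F) (hF₂ : H₂ ⊂ F) (hF₃ : H₃ ⊂ F)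
    (h12 : H₁ ≠ H₂) (h13 : H₁ ≠ H₃) (h23 : H₂ ≠ H₃) : False := by
  have hFV := hF.1
  obtain ⟨v₁, hv₁, hv₁G⟩ := Finset.exists_of_ssubset hG₁
  obtain ⟨v₂, hv₂, hv₂G⟩ := Finset.exists_of_ssubset hG₂
  obtain ⟨v₃, hv₃, hv₃G⟩ := Finset.exists_of_ssubset hG₃
  have n12 : v₁ ∉ H₂ := fun h => hv₁G (hG.mem_of_mem_between hFV hrk h₁ h₂ hG₁ hG₂ hF₁ hF₂ h12 hv₁ h)
  have n13 : v₁ ∉ H₃ := fun h => hv₁G (hG.mem_of_mem_between hFV hrk h₁ h₃ hG₁ hG₃ hF₁ hF₃ h13 hv₁ h)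
  have n21 : v₂ ∉ H₁ := fun h => hv₂G (hG.mem_of_mem_between hFV hrk h₁ h₂ hG₁ hG₂ hF₁ hF₂ h12 h hv₂)
  have n23 : v₂ ∉ H₃ := fun h => hv₂G (hG.mem_of_mem_between hFV hrk h₂ h₃ hG₂ hG₃ hF₂ hF₃ h23 hv₂ h)
  obtain ⟨hV₁, f₁, p₁, z₁⟩ := h₁
  obtain ⟨hV₂, f₂, p₂, z₂⟩ := h₂
  obtain ⟨hV₃, f₃, p₃, z₃⟩ := h₃
  obtain ⟨hVG, f, p, z⟩ := hG
  -- The span of `F` is generated by `G`, `v₁` and `v₂`.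
  have hspan : homSpan (insert v₁ (insert v₂ G)) = homSpan F := by
    refine Submodule.eq_of_le_of_finrank_le (homSpan_mono ?_) ?_
    · intro u hu
      simp only [Finset.mem_insert] at hu
      rcases hu with rfl | rfl | hu
      exacts [hF₁.1 hv₁, hF₂.1 hv₂, hF₁.1 (hG₁.1 hu)]
    · have l1 : homSpan G < homSpan (insert v₂ G) :=
        homSpan_lt_insert (fun w hw => (z w (hVG hw)).2 hw) fun h => hv₂G ((z _ (hV₂ hv₂)).1 h)
      have l2 : homSpan (insert v₂ G) < homSpan (insert v₁ (insert v₂ G)) := by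
        refine homSpan_lt_insert (f := f₂) (fun w hw => ?_) fun h => n12 ((z₂ _ (hV₁ hv₁)).1 h)
        rcases Finset.mem_insert.1 hw with rfl | hw
        exacts [(z₂ _ (hV₂ hv₂)).2 hv₂, (z₂ _ (hVG hw)).2 (hG₂.1 hw)]
      have r1 := Submodule.finrank_lt_finrank_of_lt l1
      have r2 := Submodule.finrank_lt_finrank_of_lt l2
      unfold vertexRank at hrk
      omega
  obtain ⟨a, b, eval⟩ := exists_eval_eq_of_homSpan_insert hspan (hF₃.1 hv₃)
  have e₁ := eval f₁ fun w hw => (z₁ w (hVG hw)).2 (hG₁.1 hw)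
  have e₂ := eval f₂ fun w hw => (z₂ w (hVG hw)).2 (hG₂.1 hw)
  have e₃ := eval f₃ fun w hw => (z₃ w (hVG hw)).2 (hG₃.1 hw)
  have e := eval f fun w hw => (z w (hVG hw)).2 hw
  rw [(z₁ _ (hV₁ hv₁)).2 hv₁] at e₁
  rw [(z₂ _ (hV₂ hv₂)).2 hv₂] at e₂
  rw [(z₃ _ (hV₃ hv₃)).2 hv₃] at e₃
  have q₁ : 0 < f₁ (homogenize v₂) :=
    lt_of_le_of_ne (p₁ _ (hV₂ hv₂)) fun h => n21 ((z₁ _ (hV₂ hv₂)).1 h.symm)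
  have q₂ : 0 < f₂ (homogenize v₁) :=
    lt_of_le_of_ne (p₂ _ (hV₁ hv₁)) fun h => n12 ((z₂ _ (hV₁ hv₁)).1 h.symm)
  have q₃₁ : 0 < f₃ (homogenize v₁) :=
    lt_of_le_of_ne (p₃ _ (hV₁ hv₁)) fun h => n13 ((z₃ _ (hV₁ hv₁)).1 h.symm)
  have q₃₂ : 0 < f₃ (homogenize v₂) :=
    lt_of_le_of_ne (p₃ _ (hV₂ hv₂)) fun h => n23 ((z₃ _ (hV₂ hv₂)).1 h.symm)
  have hb : 0 ≤ b := by
    by_contra! h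
    have := p₁ _ (hV₃ hv₃)
    linarith [mul_neg_of_neg_of_pos h q₁]
  have ha : 0 ≤ a := by
    by_contra! h
    have := p₂ _ (hV₃ hv₃)
    linarith [mul_neg_of_neg_of_pos h q₂]
  have ha0 : a = 0 := by
    by_contra h
    linarith [mul_pos (lt_of_le_of_ne ha (Ne.symm h)) q₃₁, mul_nonneg hb q₃₂.le]
  have hb0 : b = 0 := by
    by_contra h
    linarith [mul_pos (lt_of_le_of_ne hb (Ne.symm h)) q₃₂, mul_nonneg ha q₃₁.le]
  subst ha0 hb0
  exact hv₃G ((z _ (hV₃ hv₃)).1 (by simpa using e))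

end VertexFaces

/-! ### Face lattices and the recursion for flags -/

section FaceSystems

open scoped Classical

/-- The combinatorial data of the face lattice of a polytope that the counting arguments use: faces
are given by their vertex sets, `rk` is the dimension plus one, and a point of a face outside a
smaller face is separated from it by a facet of the larger face. -/
structure FaceSystem (ι : Type*) where
  faces : Finset (Finset ι)
  rk : Finset ι → ℕ
  top : Finset ι
  top_mem : top ∈ faces
  subset_top : ∀ {F}, F ∈ faces → F ⊆ top
  empty_mem : ∅ ∈ faces
  inter_mem : ∀ {F G}, F ∈ faces → G ∈ faces → F ∩ G ∈ faces
  rk_empty : rk ∅ = 0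
  rk_lt : ∀ {F G}, F ∈ faces → G ∈ faces → G ⊂ F → rk G < rk F
  rk_le_card : ∀ F, rk F ≤ F.card
  exists_facet : ∀ {F G}, F ∈ faces → G ∈ faces → G ⊆ F → ∀ {v}, v ∈ F → v ∉ G →
    ∃ H ∈ faces, G ⊆ H ∧ H ⊆ F ∧ v ∉ H ∧ rk H + 1 = rk F

namespace FaceSystem

variable {ι : Type*} (S : FaceSystem ι)

/-- The faces of rank `k` contained in `F`. -/
noncomputable def below (F : Finset ι) (k : ℕ) : Finset (Finset ι) :=
  S.faces.filter fun G => G ⊆ F ∧ S.rk G = k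

/-- The chains of nonempty faces strictly below `F` whose set of ranks is `D`. -/
noncomputable def flagsBelow (F : Finset ι) (D : Finset ℕ) : Finset (Finset (Finset ι)) :=
  S.faces.powerset.filter fun C =>
    (∀ G ∈ C, G.Nonempty ∧ G ⊂ F) ∧ IsChain (· ⊆ ·) (C : Set (Finset ι)) ∧ C.image S.rk = D

variable {S}

@[simp] lemma mem_below {F G : Finset ι} {k : ℕ} :
    G ∈ S.below F k ↔ G ∈ S.faces ∧ G ⊆ F ∧ S.rk G = k := by
  simp [below]

lemma mem_flagsBelow {F : Finset ι} {D : Finset ℕ} {C : Finset (Finset ι)} :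
    C ∈ S.flagsBelow F D ↔ C ⊆ S.faces ∧ (∀ G ∈ C, G.Nonempty ∧ G ⊂ F) ∧
      IsChain (· ⊆ ·) (C : Set (Finset ι)) ∧ C.image S.rk = D := by
  simp [flagsBelow]

lemma rk_mono {F G : Finset ι} (hF : F ∈ S.faces) (hG : G ∈ S.faces) (h : G ⊆ F) :
    S.rk G ≤ S.rk F := by
  rcases h.eq_or_ssubset with rfl | h
  · exact le_rfl
  · exact (S.rk_lt hF hG h).le

lemma eq_of_subset_of_rk_le {F G : Finset ι} (hF : F ∈ S.faces) (hG : G ∈ S.faces) (h : G ⊆ F)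
    (hrk : S.rk F ≤ S.rk G) : G = F := by
  by_contra hne
  exact absurd (S.rk_lt hF hG (h.ssubset_of_ne hne)) hrk.not_gt

lemma ssubset_of_rk_lt {F G : Finset ι} (h : G ⊆ F) (hrk : S.rk G < S.rk F) : G ⊂ F :=
  h.ssubset_of_ne fun h => by subst h; exact absurd hrk (lt_irrefl _)

lemma nonempty_of_rk_pos {F : Finset ι} (h : 0 < S.rk F) : F.Nonempty := by
  by_contra hF
  rw [Finset.not_nonempty_iff_eq_empty.1 hF, S.rk_empty] at h
  exact absurd h (lt_irrefl _)

lemma eq_empty_of_rk_eq_zero {F : Finset ι} (hF : F ∈ S.faces) (h : S.rk F = 0) : F = ∅ :=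
  (eq_of_subset_of_rk_le hF S.empty_mem (Finset.empty_subset F) (by omega)).symm

lemma below_zero (F : Finset ι) : S.below F 0 = {∅} := by
  ext G
  simp only [mem_below, Finset.mem_singleton]
  constructor
  · exact fun h => eq_empty_of_rk_eq_zero h.1 h.2.2
  · rintro rfl
    exact ⟨S.empty_mem, Finset.empty_subset _, S.rk_empty⟩

lemma below_rk_self {F : Finset ι} (hF : F ∈ S.faces) : S.below F (S.rk F) = {F} := by
  ext G
  simp only [mem_below, Finset.mem_singleton]
  constructor
  · exact fun h => eq_of_subset_of_rk_le hF h.1 h.2.1 h.2.2.ge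
  · rintro rfl
    exact ⟨hF, subset_rfl, rfl⟩

lemma below_eq_empty {F : Finset ι} (hF : F ∈ S.faces) {k : ℕ} (hk : S.rk F < k) :
    S.below F k = ∅ := by
  refine Finset.eq_empty_of_forall_notMem fun G hG => ?_
  rw [mem_below] at hG
  have := rk_mono hF hG.1 hG.2.1
  omega

lemma flagsBelow_empty (F : Finset ι) : S.flagsBelow F ∅ = {∅} := by
  ext C
  rw [mem_flagsBelow, Finset.image_eq_empty, Finset.mem_singleton]
  refine ⟨fun h => h.2.2.2, ?_⟩
  rintro rfl
  simp

/-- Flags are counted by their largest member. -/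
lemma card_flagsBelow_insert {F : Finset ι} {k : ℕ} {D : Finset ℕ}
    (hk : 0 < k) (hkF : k < S.rk F) (hD : ∀ j ∈ D, j < k) :
    (S.flagsBelow F (insert k D)).card = ∑ G ∈ S.below F k, (S.flagsBelow G D).card := by
  have heq : S.flagsBelow F (insert k D) =
      (S.below F k).biUnion fun G => (S.flagsBelow G D).image (insert G) := by
    ext C
    simp only [Finset.mem_biUnion, Finset.mem_image, mem_below]
    constructor
    · intro hC
      rw [mem_flagsBelow] at hC
      obtain ⟨hCf, hCF, hch, hCD⟩ := hC
      obtain ⟨G, hG, hGk⟩ := Finset.mem_image.1 (hCD ▸ Finset.mem_insert_self k D)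
      refine ⟨G, ⟨hCf hG, (hCF G hG).2.1, hGk⟩, C.erase G, ?_, Finset.insert_erase hG⟩
      have hlt : ∀ H ∈ C.erase G, H ⊂ G := by
        intro H hH
        obtain ⟨hne, hHC⟩ := Finset.mem_erase.1 hH
        rcases hch hHC hG hne with h | h
        · exact h.ssubset_of_ne hne
        · have h1 := S.rk_lt (hCf hHC) (hCf hG) (h.ssubset_of_ne hne.symm)
          have h2 : S.rk H ∈ insert k D := hCD ▸ Finset.mem_image_of_mem _ hHC
          rcases Finset.mem_insert.1 h2 with h2 | h2
          · omega
          · have := hD _ h2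
            omega
      rw [mem_flagsBelow]
      refine ⟨(Finset.erase_subset _ _).trans hCf, fun H hH =>
        ⟨(hCF H (Finset.mem_of_mem_erase hH)).1, hlt H hH⟩,
        hch.mono (Finset.coe_subset.2 (Finset.erase_subset _ _)), ?_⟩
      ext j
      rw [Finset.mem_image]
      constructor
      · rintro ⟨H, hH, rfl⟩
        have h1 := S.rk_lt (hCf hG) (hCf (Finset.mem_of_mem_erase hH)) (hlt H hH)
        have h2 : S.rk H ∈ insert k D :=
          hCD ▸ Finset.mem_image_of_mem _ (Finset.mem_of_mem_erase hH)
        exact (Finset.mem_insert.1 h2).resolve_left (by omega)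
      · intro hj
        obtain ⟨H, hH, rfl⟩ := Finset.mem_image.1 (hCD ▸ Finset.mem_insert_of_mem hj)
        refine ⟨H, Finset.mem_erase.2 ⟨?_, hH⟩, rfl⟩
        rintro rfl
        exact absurd (hD _ hj) (by omega)
    · rintro ⟨G, ⟨hGf, hGF, hGk⟩, C, hC, rfl⟩
      rw [mem_flagsBelow] at hC ⊢
      obtain ⟨hCf, hCF, hch, hCD⟩ := hC
      have hGF' : G ⊂ F := ssubset_of_rk_lt (S := S) hGF (by omega)
      refine ⟨Finset.insert_subset hGf hCf, fun H hH => ?_, ?_, ?_⟩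
      · rcases Finset.mem_insert.1 hH with rfl | hH
        · exact ⟨nonempty_of_rk_pos (S := S) (by omega), hGF'⟩
        · exact ⟨(hCF H hH).1, (hCF H hH).2.trans hGF'⟩
      · rw [Finset.coe_insert]
        exact hch.insert fun H hH _ => Or.inr (hCF H hH).2.1
      · rw [Finset.image_insert, hGk, hCD]
  rw [heq, Finset.card_biUnion]
  · refine Finset.sum_congr rfl fun G _ => Finset.card_image_of_injOn fun C hC C' hC' h => ?_
    have hn : ∀ C ∈ S.flagsBelow G D, G ∉ C := fun C hC hG =>
      ((mem_flagsBelow.1 hC).2.1 G hG).2.ne rfl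
    rw [← Finset.erase_insert (hn C hC), ← Finset.erase_insert (hn C' hC')]
    exact congrArg (Finset.erase · G) h
  · intro G hG G' hG' hne
    rw [Function.onFun, Finset.disjoint_left]
    intro C hC hC'
    obtain ⟨C, hC₁, rfl⟩ := Finset.mem_image.1 hC
    obtain ⟨C', hC₂, he⟩ := Finset.mem_image.1 hC'
    have h1 : G' ∈ insert G C := he ▸ Finset.mem_insert_self _ _
    have h2 := (Finset.mem_insert.1 h1).resolve_left hne.symm
    have h3 : S.rk G' ∈ D := (mem_flagsBelow.1 hC₁).2.2.2 ▸ Finset.mem_image_of_mem _ h2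
    have := hD _ h3
    rw [Finset.mem_coe, mem_below] at hG'
    omega

variable (S) in
/-- The face counts of an iterated pyramid over a polygon, required of every face `F`. The number
`F.card - S.rk F` is the excess of `F` over the vertex count of a simplex. -/
structure HasPyramidCounts : Prop where
  card_eq_or : ∀ {F}, F ∈ S.faces → F.card = S.rk F ∨ 3 ≤ S.rk F
  card_below : ∀ {F}, F ∈ S.faces → ∀ k, (S.below F (k + 1)).card =
    (S.rk F).choose (k + 1) + (F.card - S.rk F) * (S.rk F - 2).choose k
  sum_excess : ∀ {F}, F ∈ S.faces → ∀ k, ∑ G ∈ S.below F (k + 3), (G.card - (k + 3)) =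
    (F.card - S.rk F) * (S.rk F - 3).choose k

end FaceSystem

end FaceSystems

/-! ### The closed formula -/

section FlagFormula

open scoped Classical

/-- The weighted sum over the flag type in `flagFormula`. -/
def flagWeight {d r : ℕ} (s : Fin r → Fin d) : ℚ :=
  ∑ j : Fin r, ((extendedSeq s j.castSucc : ℚ) + 1) *
    ((extendedSeq s j.succ : ℚ) - extendedSeq s j.castSucc) * ((extendedSeq s j.succ : ℚ) - 1)

@[simp] lemma extendedSeq_castSucc {d r : ℕ} (s : Fin r → Fin d) (j : Fin r) :
    extendedSeq s j.castSucc = s j := by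
  simp [extendedSeq]

@[simp] lemma extendedSeq_last {d r : ℕ} (s : Fin r → Fin d) :
    extendedSeq s (Fin.last r) = d := by
  simp [extendedSeq]

/-- Dropping the last entry `k` of a flag type leaves a flag type in dimension `k`. -/
def dropLast {d r : ℕ} (s : Fin (r + 1) → Fin d) (hs : StrictMono s) :
    Fin r → Fin (s (Fin.last r) : ℕ) :=
  fun j => ⟨s j.castSucc, hs (Fin.castSucc_lt_last j)⟩

lemma dropLast_strictMono {d r : ℕ} (s : Fin (r + 1) → Fin d) (hs : StrictMono s) :
    StrictMono (dropLast s hs) :=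
  fun _ _ h => hs (Fin.castSucc_lt_castSucc_iff.2 h)

lemma extendedSeq_dropLast {d r : ℕ} (s : Fin (r + 1) → Fin d) (hs : StrictMono s)
    (j : Fin (r + 1)) : extendedSeq (dropLast s hs) j = s j := by
  induction j using Fin.lastCases with
  | last => simp
  | cast j => simp [dropLast]

lemma flagWeight_succ {d r : ℕ} (s : Fin (r + 1) → Fin d) (hs : StrictMono s) :
    flagWeight s = flagWeight (dropLast s hs) +
      ((s (Fin.last r) : ℕ) + 1 : ℚ) * ((d : ℚ) - (s (Fin.last r) : ℕ)) * ((d : ℚ) - 1) := by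
  rw [flagWeight, Fin.sum_univ_castSucc, flagWeight]
  congr 1
  · refine Finset.sum_congr rfl fun j _ => ?_
    rw [extendedSeq_dropLast, extendedSeq_dropLast, Fin.succ_castSucc, extendedSeq_castSucc,
      extendedSeq_castSucc]
  · rw [Fin.succ_last, extendedSeq_last, extendedSeq_castSucc]

lemma flagParts_castSucc {d r : ℕ} (s : Fin (r + 1) → Fin d) (hs : StrictMono s)
    (j : Fin (r + 1)) : flagParts s j.castSucc = flagParts (dropLast s hs) j := by
  cases j using Fin.cases with
  | zero =>
    rw [Fin.castSucc_zero, flagParts, flagParts, Fin.cons_zero, Fin.cons_zero,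
      extendedSeq_dropLast, ← Fin.castSucc_zero, extendedSeq_castSucc]
  | succ j =>
    rw [← Fin.succ_castSucc, flagParts, flagParts, Fin.cons_succ, Fin.cons_succ,
      extendedSeq_dropLast, extendedSeq_dropLast, Fin.succ_castSucc, extendedSeq_castSucc,
      extendedSeq_castSucc]

lemma flagParts_last {d r : ℕ} (s : Fin (r + 1) → Fin d) :
    flagParts s (Fin.last (r + 1)) = d - s (Fin.last r) := by
  rw [← Fin.succ_last, flagParts, Fin.cons_succ, Fin.succ_last, extendedSeq_last,
    extendedSeq_castSucc]

lemma sum_flagParts : ∀ {d r : ℕ} (s : Fin r → Fin d), StrictMono s →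
    ∑ j, flagParts s j = d + 1
  | d, 0, s, _ => by simp [flagParts, extendedSeq, Fin.snoc]
  | d, r + 1, s, hs => by
    rw [Fin.sum_univ_castSucc]
    simp only [flagParts_castSucc s hs, flagParts_last]
    rw [sum_flagParts _ (dropLast_strictMono s hs)]
    have := (s (Fin.last r)).2
    omega

lemma multinomial_flagParts_zero {d : ℕ} (s : Fin 0 → Fin d) :
    Nat.multinomial Finset.univ (flagParts s) = 1 := by
  rw [show (Finset.univ : Finset (Fin (0 + 1))) = {0} from rfl, Nat.multinomial_singleton]

lemma multinomial_flagParts_succ {d r : ℕ} (s : Fin (r + 1) → Fin d) (hs : StrictMono s) :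
    Nat.multinomial Finset.univ (flagParts s) =
      (d + 1).choose (s (Fin.last r) + 1) *
        Nat.multinomial Finset.univ (flagParts (dropLast s hs)) := by
  have h1 := Nat.multinomial_spec Finset.univ (flagParts s)
  have h2 := Nat.multinomial_spec Finset.univ (flagParts (dropLast s hs))
  rw [sum_flagParts s hs, Fin.prod_univ_castSucc] at h1
  simp only [flagParts_castSucc s hs, flagParts_last] at h1
  rw [sum_flagParts _ (dropLast_strictMono s hs)] at h2
  have hk := (s (Fin.last r)).2
  have h3 := Nat.choose_mul_factorial_mul_factorial
    (show (s (Fin.last r) : ℕ) + 1 ≤ d + 1 by omega)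
  rw [show d + 1 - ((s (Fin.last r) : ℕ) + 1) = d - s (Fin.last r) by omega, ← h1, ← h2] at h3
  have h4 : 0 < (∏ i, (flagParts (dropLast s hs) i).factorial) *
      (d - s (Fin.last r)).factorial :=
    Nat.mul_pos (Finset.prod_pos fun i _ => Nat.factorial_pos _) (Nat.factorial_pos _)
  refine Nat.eq_of_mul_eq_mul_left h4 ?_
  rw [← h3]
  ring

lemma flagFormula_eq (d n : ℕ) {r : ℕ} (s : Fin r → Fin d) :
    flagFormula d n s = (Nat.multinomial Finset.univ (flagParts s) : ℚ) *
      (1 + ((n : ℚ) - d) / (((d : ℚ) + 1) * d * ((d : ℚ) - 1)) * flagWeight s) := rfl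

/-- In dimension at most one every summand of the weight vanishes. -/
lemma flagWeight_eq_zero {d r : ℕ} (hd : d ≤ 1) (s : Fin r → Fin d) : flagWeight s = 0 := by
  refine Finset.sum_eq_zero fun j _ => ?_
  obtain rfl : d = 1 := by have := (s j).2; omega
  rw [extendedSeq_castSucc, Fin.val_eq_zero]
  by_cases hj : j.succ = Fin.last r
  · rw [hj, extendedSeq_last]; simp
  · obtain ⟨i, hi⟩ := Fin.exists_castSucc_eq.2 hj
    rw [← hi, extendedSeq_castSucc, Fin.val_eq_zero]; simp

lemma choose_mul_succ_mul_sub (d k : ℕ) (hd : 1 ≤ d) (hk : k ≤ d) :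
    ((d - 1).choose k : ℚ) * ((d + 1) * d) = (d + 1).choose (k + 1) * ((k + 1) * (d - k)) := by
  obtain ⟨d, rfl⟩ := Nat.exists_eq_add_of_le' hd
  have h1 := Nat.add_one_mul_choose_eq (d + 1) k
  have h2 := Nat.choose_mul_succ_eq d k
  have h3 : ((d + 1 - k : ℕ) : ℚ) = (d + 1 : ℕ) - (k : ℚ) := by push_cast [Nat.cast_sub hk]; ring
  qify at h1 h2
  rw [h3] at h2
  simp only [Nat.add_sub_cancel] at *
  push_cast at *
  linear_combination (d + 1 + 1 : ℚ) * h2 + (d + 1 - k : ℚ) * h1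

lemma choose_sub_three_mul (d k : ℕ) :
    (d.choose k : ℚ) * ((d + 3) * (d + 2) * (d + 1)) =
      (d + 3).choose (k + 3) * ((k + 3) * (k + 2) * (k + 1)) := by
  have h1 := Nat.add_one_mul_choose_eq d k
  have h2 := Nat.add_one_mul_choose_eq (d + 1) (k + 1)
  have h3 := Nat.add_one_mul_choose_eq (d + 2) (k + 2)
  qify at h1 h2 h3
  linear_combination (d + 3 : ℚ) * (d + 2) * h1 + (d + 3 : ℚ) * (k + 1) * h2 +
    (k + 1 : ℚ) * (k + 2) * h3

open FaceSystem in
/-- The face counts of iterated pyramids over polygons determine all flag numbers: the flags with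
largest member `G` are counted by the formula for `G`, which is linear in the excess of `G`. -/
theorem FaceSystem.HasPyramidCounts.card_flagsBelow {ι : Type*} {S : FaceSystem ι}
    (hS : S.HasPyramidCounts) : ∀ {r d n : ℕ} {F : Finset ι}, F ∈ S.faces → S.rk F = d + 1 →
      F.card = n + 1 → ∀ s : Fin r → Fin d, StrictMono s →
        ((S.flagsBelow F (Finset.univ.image fun j => (s j : ℕ) + 1)).card : ℚ) =
          flagFormula d n s
  | 0, d, n, F, _, _, _, s, _ => by
    rw [Finset.univ_eq_empty, Finset.image_empty, flagsBelow_empty, flagFormula_eq,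
      multinomial_flagParts_zero, flagWeight]
    simp
  | r + 1, d, n, F, hF, hrk, hcard, s, hs => by
    obtain ⟨k, hk⟩ : ∃ k : ℕ, k = s (Fin.last r) := ⟨_, rfl⟩
    have hkd : k < d := hk ▸ (s (Fin.last r)).2
    have hD : (Finset.univ.image fun j => (s j : ℕ) + 1) =
        insert (k + 1) (Finset.univ.image fun j => (dropLast s hs j : ℕ) + 1) := by
      ext i
      simp only [Finset.mem_image, Finset.mem_univ, true_and, Finset.mem_insert, hk]
      constructor
      · rintro ⟨j, rfl⟩
        induction j using Fin.lastCases with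
        | last => exact Or.inl rfl
        | cast j => exact Or.inr ⟨j, rfl⟩
      · rintro (rfl | ⟨j, rfl⟩)
        exacts [⟨_, rfl⟩, ⟨j.castSucc, rfl⟩]
    rw [hD, card_flagsBelow_insert (Nat.succ_pos k) (by omega) (by
      intro j hj
      obtain ⟨i, -, rfl⟩ := Finset.mem_image.1 hj
      have := (dropLast s hs i).2
      omega)]
    have hle := S.rk_le_card F
    have hnd : ((F.card - S.rk F : ℕ) : ℚ) = (n : ℚ) - d := by
      rw [Nat.cast_sub hle, hrk, hcard]; push_cast; ring
    have hcnt := hS.card_below hF k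
    qify at hcnt
    rw [hnd, hrk] at hcnt
    obtain ⟨M, hM⟩ : ∃ M, M = Nat.multinomial Finset.univ (flagParts (dropLast s hs)) := ⟨_, rfl⟩
    obtain ⟨w, hw⟩ : ∃ w, w = flagWeight (dropLast s hs) := ⟨_, rfl⟩
    have hG : ∀ G ∈ S.below F (k + 1), ((S.flagsBelow G
        (Finset.univ.image fun j => (dropLast s hs j : ℕ) + 1)).card : ℚ) =
        M + M * w / ((k + 1) * k * (k - 1)) * ((G.card - (k + 1) : ℕ) : ℚ) := by
      intro G hG
      rw [mem_below] at hG
      have h1 := S.rk_le_card G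
      obtain ⟨m, hm⟩ : ∃ m, G.card = m + 1 := ⟨G.card - 1, by omega⟩
      rw [hS.card_flagsBelow hG.1 (hk ▸ hG.2.2) hm _ (dropLast_strictMono s hs), flagFormula_eq,
        ← hM, ← hw, ← hk, hm, Nat.cast_sub (by omega)]
      push_cast
      ring
    rw [Nat.cast_sum, Finset.sum_congr rfl hG, Finset.sum_add_distrib, Finset.sum_const,
      ← Finset.mul_sum, nsmul_eq_mul, hcnt, flagFormula_eq, flagWeight_succ s hs,
      multinomial_flagParts_succ s hs, ← hM, ← hw, ← hk]
    push_cast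
    have hch := choose_mul_succ_mul_sub d k (by omega) hkd.le
    have hd0 : (d : ℚ) ≠ 0 := by norm_cast; omega
    have hd1 : (d : ℚ) + 1 ≠ 0 := by positivity
    rw [← eq_div_iff (by positivity)] at hch
    rw [hch]
    rcases Nat.lt_or_ge k 2 with hk2 | hk2
    · rw [show w = 0 from hw ▸ flagWeight_eq_zero (by omega) _]
      rcases Nat.lt_or_ge d 2 with hd2 | hd2
      · have h0 : (n : ℚ) - d = 0 := by
          rcases hS.card_eq_or hF with h | h
          · rw [← hnd, h, Nat.sub_self, Nat.cast_zero]
          · omega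
        rw [h0]; simp
      · have hdm : (d : ℚ) - 1 ≠ 0 := by
          have : (2 : ℚ) ≤ d := by exact_mod_cast hd2
          linarith
        field_simp
        ring
    · obtain ⟨k, rfl⟩ := Nat.exists_eq_add_of_le' hk2
      obtain ⟨d, rfl⟩ := Nat.exists_eq_add_of_le' (show 2 ≤ d by omega)
      have hex := hS.sum_excess hF k
      qify at hex
      rw [hnd, hrk, show d + 2 + 1 - 3 = d by omega] at hex
      have hch' := choose_sub_three_mul d k
      rw [← eq_div_iff (by positivity)] at hch'
      rw [hch'] at hex
      simp only [show k + 2 + 1 = k + 3 by omega, show d + 2 + 1 = d + 3 by omega]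
      rw [hex]
      push_cast
      have e1 : (k : ℚ) + 2 - 1 = k + 1 := by ring
      have e2 : (d : ℚ) + 2 - 1 = d + 1 := by ring
      rw [e1, e2]
      field_simp
      ring

end FlagFormula

/-! ### Exposed faces of convex hulls of finite sets -/

section ConvexHullFaces

open scoped Classical

variable {E : Type*} [NormedAddCommGroup E] [NormedSpace ℝ E]

/-- The faces of `convexHull V`, recorded by their points in `V`. -/
noncomputable def polytopeFaces (V : Finset E) : FaceSystem E where
  faces := V.powerset.filter (IsVertexFace V)
  rk := vertexRank
  top := V
  top_mem := by simp [isVertexFace_self]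
  subset_top h := by simpa using (Finset.mem_filter.1 h).1
  empty_mem := by simp [isVertexFace_empty]
  inter_mem hF hG := by
    simp only [Finset.mem_filter, Finset.mem_powerset] at *
    exact ⟨Finset.inter_subset_left.trans hF.1, hF.2.inter hG.2⟩
  rk_empty := vertexRank_empty
  rk_lt hF hG h := by
    simp only [Finset.mem_filter, Finset.mem_powerset] at *
    exact hG.2.vertexRank_lt hF.1 h
  rk_le_card := vertexRank_le_card
  exists_facet hF hG h v hv hvG := by
    simp only [Finset.mem_filter, Finset.mem_powerset] at *
    obtain ⟨H, hH, h1⟩ := hF.2.exists_facet hG.2 h hv hvG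
    exact ⟨H, ⟨hH.1, hH⟩, h1⟩

@[simp] lemma mem_polytopeFaces {V F : Finset E} :
    F ∈ (polytopeFaces V).faces ↔ IsVertexFace V F := by
  simp only [polytopeFaces, Finset.mem_filter, Finset.mem_powerset, and_iff_right_iff_imp]
  exact fun h => h.1

@[simp] lemma polytopeFaces_rk (V F : Finset E) : (polytopeFaces V).rk F = vertexRank F := rfl

lemma homSpan_eq_sup {F : Finset E} {p : E} (hp : p ∈ F) :
    homSpan F = Submodule.span ℝ {homogenize p} ⊔
      (vectorSpan ℝ (F : Set E)).map (LinearMap.inl ℝ E ℝ) := by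
  refine le_antisymm (homSpan_le_iff.2 fun v hv => ?_) (sup_le ?_ ?_)
  · rw [show homogenize v = homogenize p + LinearMap.inl ℝ E ℝ (v - p) by
      simp [homogenize]]
    exact Submodule.add_mem_sup (Submodule.mem_span_singleton_self _)
      (Submodule.mem_map_of_mem (vsub_mem_vectorSpan ℝ hv hp))
  · rw [Submodule.span_le, Set.singleton_subset_iff]
    exact homogenize_mem_homSpan hp
  · rw [Submodule.map_le_iff_le_comap, vectorSpan_def, Submodule.span_le]
    rintro _ ⟨v, hv, w, hw, rfl⟩
    have : LinearMap.inl ℝ E ℝ (v -ᵥ w) = homogenize v - homogenize w := by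
      simp [homogenize]
    rw [SetLike.mem_coe, Submodule.mem_comap, this]
    exact sub_mem (homogenize_mem_homSpan hv) (homogenize_mem_homSpan hw)

lemma vertexRank_eq_convexDim {F : Finset E} (hF : F.Nonempty) :
    vertexRank F = convexDim (convexHull ℝ (F : Set E)) + 1 := by
  obtain ⟨p, hp⟩ := hF
  have hdim : convexDim (convexHull ℝ (F : Set E)) =
      Module.finrank ℝ (vectorSpan ℝ (F : Set E)) := by
    rw [convexDim, ← direction_affineSpan, affineSpan_convexHull, direction_affineSpan]
  have hspan := homSpan_eq_sup hp
  have hfin : FiniteDimensional ℝ (vectorSpan ℝ (F : Set E)) :=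
    finiteDimensional_vectorSpan_of_finite ℝ F.finite_toSet
  have hinf : Submodule.span ℝ {homogenize p} ⊓
      (vectorSpan ℝ (F : Set E)).map (LinearMap.inl ℝ E ℝ) = ⊥ := by
    rw [eq_bot_iff]
    rintro x ⟨h1, h2⟩
    obtain ⟨a, rfl⟩ := Submodule.mem_span_singleton.1 h1
    obtain ⟨w, -, hw⟩ := h2
    have : a = 0 := by simpa [homogenize] using (congrArg Prod.snd hw).symm
    simp [this]
  have h := Submodule.finrank_sup_add_finrank_inf_eq (Submodule.span ℝ {homogenize p})
    ((vectorSpan ℝ (F : Set E)).map (LinearMap.inl ℝ E ℝ))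
  rw [hinf, finrank_bot, ← hspan, finrank_span_singleton (by simp [homogenize]),
    ← (Submodule.equivMapOfInjective _ LinearMap.inl_injective _).finrank_eq, ← hdim] at h
  rw [vertexRank]
  omega

lemma apply_homogenize_sum (f : Module.Dual ℝ (E × ℝ)) {V : Finset E} {w : E → ℝ}
    (hw : ∑ v ∈ V, w v = 1) :
    f (homogenize (∑ v ∈ V, w v • v)) = ∑ v ∈ V, w v * f (homogenize v) := by
  have : homogenize (∑ v ∈ V, w v • v) = ∑ v ∈ V, w v • homogenize v := by
    ext
    · simp [homogenize, Prod.fst_sum]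
    · simp [homogenize, Prod.snd_sum, hw]
  simp [this]

lemma apply_homogenize_nonneg {f : Module.Dual ℝ (E × ℝ)} {V : Finset E}
    (hf : ∀ v ∈ V, 0 ≤ f (homogenize v)) {p : E} (hp : p ∈ convexHull ℝ (V : Set E)) :
    0 ≤ f (homogenize p) := by
  obtain ⟨w, hw, h1, rfl⟩ := Finset.mem_convexHull'.1 hp
  rw [apply_homogenize_sum f h1]
  exact Finset.sum_nonneg fun v hv => mul_nonneg (hw v hv) (hf v hv)

/-- A point of `convexHull V` at which a nonnegative functional vanishes is a convex combination of
zeros of the functional in `V`. -/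
lemma mem_convexHull_zeroSet {f : Module.Dual ℝ (E × ℝ)} {V : Finset E}
    (hf : ∀ v ∈ V, 0 ≤ f (homogenize v)) {p : E} (hp : p ∈ convexHull ℝ (V : Set E))
    (hfp : f (homogenize p) = 0) :
    p ∈ convexHull ℝ ((V.filter fun v => f (homogenize v) = 0 : Finset E) : Set E) := by
  obtain ⟨w, hw, h1, rfl⟩ := Finset.mem_convexHull'.1 hp
  rw [apply_homogenize_sum f h1,
    Finset.sum_eq_zero_iff_of_nonneg fun v hv => mul_nonneg (hw v hv) (hf v hv)] at hfp
  have hz : ∀ v ∈ V, f (homogenize v) ≠ 0 → w v = 0 := fun v hv hne =>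
    (mul_eq_zero.1 (hfp v hv)).resolve_right hne
  refine Finset.mem_convexHull'.2 ⟨w, fun v hv => hw v (Finset.mem_of_mem_filter v hv), ?_, ?_⟩
  · rw [← h1]
    exact Finset.sum_filter_of_ne fun v hv hne => by
      by_contra h; exact hne (hz v hv h)
  · exact Finset.sum_filter_of_ne fun v hv hne => by
      by_contra h; exact hne (by rw [hz v hv h, zero_smul])

lemma apply_homogenize_eq_zero {f : Module.Dual ℝ (E × ℝ)} {F : Finset E}
    (hf : ∀ v ∈ F, f (homogenize v) = 0) {p : E} (hp : p ∈ convexHull ℝ (F : Set E)) :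
    f (homogenize p) = 0 := by
  obtain ⟨w, hw, h1, rfl⟩ := Finset.mem_convexHull'.1 hp
  rw [apply_homogenize_sum f h1]
  exact Finset.sum_eq_zero fun v hv => by rw [hf v hv, mul_zero]

lemma IsVertexFace.mem_of_mem_convexHull {V F : Finset E} (hF : IsVertexFace V F) {v : E}
    (hv : v ∈ V) (h : v ∈ convexHull ℝ (F : Set E)) : v ∈ F := by
  obtain ⟨hFV, f, hf, hf0⟩ := hF
  exact (hf0 v hv).1 (apply_homogenize_eq_zero (fun w hw => (hf0 w (hFV hw)).2 hw) h)

lemma IsVertexFace.convexHull_subset_iff {V F G : Finset E} (hF : IsVertexFace V F)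
    (hG : IsVertexFace V G) :
    convexHull ℝ (G : Set E) ⊆ convexHull ℝ (F : Set E) ↔ G ⊆ F := by
  refine ⟨fun h v hv => hF.mem_of_mem_convexHull (hG.1 hv) (h (subset_convexHull ℝ _ hv)),
    fun h => convexHull_mono (Finset.coe_subset.2 h)⟩

lemma convexHull_injOn_isVertexFace (V : Finset E) :
    Set.InjOn (fun F : Finset E => convexHull ℝ (F : Set E)) {F | IsVertexFace V F} :=
  fun _ hF _ hG h => Finset.Subset.antisymm ((hG.convexHull_subset_iff hF).1 h.le)
    ((hF.convexHull_subset_iff hG).1 h.ge)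

lemma IsVertexFace.isExposed [FiniteDimensional ℝ E] {V F : Finset E} (hF : IsVertexFace V F) :
    IsExposed ℝ (convexHull ℝ (V : Set E)) (convexHull ℝ (F : Set E)) := by
  obtain ⟨hFV, f, hf, hf0⟩ := hF
  intro hne
  obtain ⟨p, hp⟩ := hne
  have hsplit : ∀ x y : E, f (x, 0) - f (y, 0) = f (homogenize x) - f (homogenize y) := by
    intro x y
    rw [← map_sub, ← map_sub]
    simp [homogenize]
  have hF0 : ∀ w ∈ F, f (homogenize w) = 0 := fun w hw => (hf0 w (hFV hw)).2 hw
  have hfilter : (V.filter fun v => f (homogenize v) = 0) = F := by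
    ext v
    rw [Finset.mem_filter]
    exact ⟨fun h => (hf0 v h.1).1 h.2, fun h => ⟨hFV h, hF0 v h⟩⟩
  refine ⟨LinearMap.toContinuousLinearMap (-(f ∘ₗ LinearMap.inl ℝ E ℝ)), ?_⟩
  ext x
  simp only [Set.mem_ofPred_eq, LinearMap.coe_toContinuousLinearMap', LinearMap.neg_apply,
    LinearMap.comp_apply, LinearMap.inl_apply]
  constructor
  · intro hx
    refine ⟨convexHull_mono (Finset.coe_subset.2 hFV) hx, fun y hy => ?_⟩
    have h1 := hsplit x y
    rw [apply_homogenize_eq_zero hF0 hx] at h1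
    linarith [apply_homogenize_nonneg hf hy]
  · rintro ⟨hx, hmax⟩
    have h1 := hsplit x p
    rw [apply_homogenize_eq_zero hF0 hp] at h1
    have h2 := hmax p (convexHull_mono (Finset.coe_subset.2 hFV) hp)
    have h3 := apply_homogenize_nonneg hf hx
    have := mem_convexHull_zeroSet hf hx (by linarith)
    rwa [hfilter] at this

lemma exists_isVertexFace_of_isExposed {V : Finset E} {A : Set E}
    (hA : IsExposed ℝ (convexHull ℝ (V : Set E)) A) (hne : A.Nonempty) :
    ∃ F, IsVertexFace V F ∧ A = convexHull ℝ (F : Set E) := by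
  obtain ⟨l, hl⟩ := hA hne
  obtain ⟨p, hp⟩ := hne
  rw [hl] at hp
  let f : Module.Dual ℝ (E × ℝ) :=
    l p • LinearMap.snd ℝ E ℝ - (l : E →ₗ[ℝ] ℝ) ∘ₗ LinearMap.fst ℝ E ℝ
  have hfv : ∀ v, f (homogenize v) = l p - l v := fun v => by simp [f, homogenize]
  have hf : ∀ v ∈ V, 0 ≤ f (homogenize v) := fun v hv => by
    rw [hfv]; linarith [hp.2 v (subset_convexHull ℝ _ hv)]
  refine ⟨V.filter fun v => f (homogenize v) = 0,
    ⟨Finset.filter_subset _ _, f, hf, fun v hv => by simp [hv]⟩, Set.Subset.antisymm ?_ ?_⟩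
  · intro x hx
    rw [hl] at hx
    refine mem_convexHull_zeroSet hf hx.1 ?_
    rw [hfv]
    linarith [hx.2 p hp.1, hp.2 x hx.1]
  · intro x hx
    have h0 := apply_homogenize_eq_zero (fun w hw => (Finset.mem_filter.1 hw).2) hx
    rw [hfv] at h0
    rw [hl]
    refine ⟨convexHull_mono (Finset.coe_subset.2 (Finset.filter_subset _ _)) hx, fun y hy => ?_⟩
    linarith [hp.2 y hy]

lemma isProperFace_convexHull_iff [FiniteDimensional ℝ E] {V : Finset E} {A : Set E} :
    IsProperFace (convexHull ℝ (V : Set E)) A ↔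
      ∃ F, (IsVertexFace V F ∧ F.Nonempty ∧ F ⊂ V) ∧ convexHull ℝ (F : Set E) = A := by
  constructor
  · rintro ⟨hA, hne, hP⟩
    obtain ⟨F, hF, rfl⟩ := exists_isVertexFace_of_isExposed hA hne
    refine ⟨F, ⟨hF, ?_, hF.1.ssubset_of_ne fun h => hP (by rw [h])⟩, rfl⟩
    simpa using hne
  · rintro ⟨F, ⟨hF, hne, hFV⟩, rfl⟩
    refine ⟨hF.isExposed, by simpa using hne, fun h => hFV.ne ?_⟩
    exact convexHull_injOn_isVertexFace V hF (isVertexFace_self V) h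

/-- The entries of the flag vector count the combinatorial flags of `polytopeFaces`. -/
lemma flagVector_convexHull [FiniteDimensional ℝ E] (V : Finset E) (d : ℕ) (T : Finset (Fin d)) :
    flagVector d (convexHull ℝ (V : Set E)) T =
      ((polytopeFaces V).flagsBelow V (T.image fun k : Fin d => (k : ℕ) + 1)).card := by
  set Φ : Finset E → Set E := fun F => convexHull ℝ (F : Set E) with hΦ
  have hinj := convexHull_injOn_isVertexFace V
  rw [flagVector, ← Set.ncard_coe_finset]
  symm
  refine Set.ncard_congr (fun C _ => Φ '' (C : Set (Finset E))) ?_ ?_ ?_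
  · intro C hC
    rw [Finset.mem_coe, FaceSystem.mem_flagsBelow] at hC
    obtain ⟨hCf, hCV, hch, hD⟩ := hC
    have hface : ∀ F ∈ C, IsVertexFace V F := fun F hF => mem_polytopeFaces.1 (hCf hF)
    refine ⟨?_, ?_, ?_⟩
    · rintro _ ⟨F, hF, rfl⟩
      exact isProperFace_convexHull_iff.2 ⟨F, ⟨hface F hF, hCV F hF⟩, rfl⟩
    · rintro _ ⟨F, hF, rfl⟩ _ ⟨G, hG, rfl⟩ hne
      rcases hch hF hG (fun h => hne (by rw [h])) with h | h
      · exact Or.inl (convexHull_mono (Finset.coe_subset.2 h))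
      · exact Or.inr (convexHull_mono (Finset.coe_subset.2 h))
    · ext j
      have hj : j + 1 ∈ C.image (polytopeFaces V).rk ↔
        j + 1 ∈ T.image fun k : Fin d => (k : ℕ) + 1 := by rw [hD]
      simp only [Finset.mem_image, polytopeFaces_rk, add_left_inj] at hj
      simp only [Set.mem_image, Finset.mem_coe, exists_exists_and_eq_and]
      rw [← hj]
      refine exists_congr fun F => and_congr_right fun hF => ?_
      rw [vertexRank_eq_convexDim (hCV F hF).1, add_left_inj]
  · intro C C' hC hC' h
    rw [Finset.mem_coe, FaceSystem.mem_flagsBelow] at hC hC'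
    have h1 := hinj.image_eq_image_iff (fun F hF => mem_polytopeFaces.1 (hC.1 hF))
      (fun F hF => mem_polytopeFaces.1 (hC'.1 hF)) |>.1 h
    exact Finset.coe_injective h1
  · intro K hK
    obtain ⟨hKf, hch, hD⟩ := hK
    have hface : ∀ A ∈ K, ∃ F, (IsVertexFace V F ∧ F.Nonempty ∧ F ⊂ V) ∧ Φ F = A :=
      fun A hA => isProperFace_convexHull_iff.1 (hKf A hA)
    let C : Finset (Finset E) := V.powerset.filter fun F =>
      (IsVertexFace V F ∧ F.Nonempty ∧ F ⊂ V) ∧ Φ F ∈ K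
    have hC : ∀ F, F ∈ C ↔ (IsVertexFace V F ∧ F.Nonempty ∧ F ⊂ V) ∧ Φ F ∈ K := by
      intro F
      simp only [C, Finset.mem_filter, Finset.mem_powerset, and_iff_right_iff_imp]
      exact fun h => h.1.1.1
    have himage : Φ '' (C : Set (Finset E)) = K := by
      ext A
      constructor
      · rintro ⟨F, hF, rfl⟩
        exact ((hC F).1 hF).2
      · intro hA
        obtain ⟨F, hF, rfl⟩ := hface A hA
        exact ⟨F, (hC F).2 ⟨hF, hA⟩, rfl⟩
    refine ⟨C, ?_, himage⟩
    rw [Finset.mem_coe, FaceSystem.mem_flagsBelow]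
    refine ⟨fun F hF => mem_polytopeFaces.2 ((hC F).1 hF).1.1, fun F hF => ((hC F).1 hF).1.2,
      ?_, ?_⟩
    · intro F hF G hG hne
      obtain ⟨⟨hF1, -⟩, hF2⟩ := (hC F).1 hF
      obtain ⟨⟨hG1, -⟩, hG2⟩ := (hC G).1 hG
      rcases hch hF2 hG2 fun h => hne (hinj hF1 hG1 h) with h | h
      · exact Or.inl ((hG1.convexHull_subset_iff hF1).1 h)
      · exact Or.inr ((hF1.convexHull_subset_iff hG1).1 h)
    · ext j
      have hdim : ∀ F ∈ C, (polytopeFaces V).rk F = convexDim (Φ F) + 1 := fun F hF =>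
        vertexRank_eq_convexDim ((hC F).1 hF).1.2.1
      rw [← himage] at hD
      constructor
      · intro h
        obtain ⟨F, hF, rfl⟩ := Finset.mem_image.1 h
        have : convexDim (Φ F) ∈ (fun k : Fin d => (k : ℕ)) '' (T : Set (Fin d)) :=
          hD ▸ ⟨Φ F, ⟨F, hF, rfl⟩, rfl⟩
        obtain ⟨k, hk, hkF⟩ := this
        exact Finset.mem_image.2 ⟨k, hk, by rw [hdim F hF, ← hkF]⟩
      · intro h
        obtain ⟨k, hk, rfl⟩ := Finset.mem_image.1 h
        have : (k : ℕ) ∈ convexDim '' (Φ '' (C : Set (Finset E))) := hD ▸ ⟨k, hk, rfl⟩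
        obtain ⟨_, ⟨F, hF, rfl⟩, hkF⟩ := this
        exact Finset.mem_image.2 ⟨F, hF, by rw [hdim F hF, hkF]⟩

end ConvexHullFaces

/-! ### Polygons -/

section Polygons

open scoped Classical

variable {E : Type*} [NormedAddCommGroup E] [NormedSpace ℝ E]

/-- Extreme points of a polytope are exposed: they can be strictly separated from the hull of the
other points. -/
lemma isVertexFace_singleton {V : Finset E} {v : E}
    (hv : v ∈ (convexHull ℝ (V : Set E)).extremePoints ℝ) : IsVertexFace V {v} := by
  have hvV : v ∈ V := extremePoints_convexHull_subset hv
  have hnot : v ∉ convexHull ℝ ((V.erase v : Finset E) : Set E) := by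
    have h := ((convex_convexHull ℝ _).mem_extremePoints_iff_mem_sdiff_convexHull_sdiff.1 hv).2
    refine fun h' => h (convexHull_mono (fun w hw => ?_) h')
    have hw := Finset.mem_erase.1 hw
    exact ⟨subset_convexHull ℝ _ hw.2, hw.1⟩
  obtain ⟨l, u, hu, hl⟩ := geometric_hahn_banach_point_closed (convex_convexHull ℝ _)
    (Set.Finite.isClosed_convexHull (𝕜 := ℝ) (V.erase v).finite_toSet) hnot
  have hlt : ∀ w ∈ V, w ≠ v → l v < l w := fun w hw hne =>
    hu.trans (hl w (subset_convexHull ℝ _ (Finset.mem_erase.2 ⟨hne, hw⟩)))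
  refine ⟨Finset.singleton_subset_iff.2 hvV,
    (l : E →ₗ[ℝ] ℝ) ∘ₗ LinearMap.fst ℝ E ℝ - l v • LinearMap.snd ℝ E ℝ, ?_, ?_⟩
  · intro w hw
    by_cases h : w = v
    · simp [h, homogenize]
    · simpa [homogenize] using (hlt w hw h).le
  · intro w hw
    by_cases h : w = v
    · simp [h, homogenize]
    · simpa [homogenize, h, sub_eq_zero] using (hlt w hw h).ne'

lemma vertexRank_singleton (v : E) : vertexRank ({v} : Finset E) = 1 := by
  rw [vertexRank, homSpan, Finset.coe_singleton, Set.image_singleton,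
    finrank_span_singleton (by simp [homogenize])]

lemma vertexRank_pos {F : Finset E} (hF : F.Nonempty) : 0 < vertexRank F := by
  rw [vertexRank_eq_convexDim hF]; omega

lemma eq_singleton_of_vertexRank_eq_one {V F : Finset E} (hV : ∀ v ∈ V, IsVertexFace V {v})
    (hF : IsVertexFace V F) (hrk : vertexRank F = 1) : ∃ v, F = {v} := by
  obtain ⟨v, hv⟩ : F.Nonempty := by
    by_contra h
    rw [Finset.not_nonempty_iff_eq_empty.1 h, vertexRank_empty] at hrk
    omega
  refine ⟨v, by_contra fun hne => ?_⟩
  have := (hV v (hF.1 hv)).vertexRank_lt hF.1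
    ((Finset.singleton_subset_iff.2 hv).ssubset_of_ne (Ne.symm hne))
  rw [vertexRank_singleton] at this
  omega

lemma card_eq_two_of_vertexRank_eq_two {V F : Finset E} (hV : ∀ v ∈ V, IsVertexFace V {v})
    (hF : IsVertexFace V F) (hrk : vertexRank F = 2) : F.card = 2 := by
  refine le_antisymm (not_lt.1 fun h => ?_) (hrk ▸ vertexRank_le_card F)
  obtain ⟨a, b, c, ha, hb, hc, hab, hac, hbc⟩ := Finset.two_lt_card_iff.1 h
  have hss : ∀ v ∈ F, ({v} : Finset E) ⊂ F := fun v hv =>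
    (Finset.singleton_subset_iff.2 hv).ssubset_of_ne fun h' => by
      rw [← h', Finset.card_singleton] at h; omega
  have he : ∀ v : E, (∅ : Finset E) ⊂ {v} := fun v => (Finset.singleton_nonempty v).empty_ssubset
  exact hF.not_three_between (isVertexFace_empty V) (by rw [hrk, vertexRank_empty])
    (hV a (hF.1 ha)) (hV b (hF.1 hb)) (hV c (hF.1 hc)) (he a) (he b) (he c)
    (hss a ha) (hss b hb) (hss c hc) (by simpa using hab) (by simpa using hac)
    (by simpa using hbc)

lemma below_one_eq_image {V F : Finset E} (hV : ∀ v ∈ V, IsVertexFace V {v})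
    (hF : F ⊆ V) : (polytopeFaces V).below F 1 = F.image fun v => {v} := by
  ext G
  simp only [FaceSystem.mem_below, mem_polytopeFaces, polytopeFaces_rk, Finset.mem_image]
  constructor
  · rintro ⟨hG, hGF, hrk⟩
    obtain ⟨v, rfl⟩ := eq_singleton_of_vertexRank_eq_one hV hG hrk
    exact ⟨v, Finset.singleton_subset_iff.1 hGF, rfl⟩
  · rintro ⟨v, hv, rfl⟩
    exact ⟨hV v (hF hv), Finset.singleton_subset_iff.2 hv, vertexRank_singleton v⟩

lemma card_below_one {V F : Finset E} (hV : ∀ v ∈ V, IsVertexFace V {v})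
    (hF : F ⊆ V) : ((polytopeFaces V).below F 1).card = F.card := by
  rw [below_one_eq_image hV hF, Finset.card_image_of_injective _ Finset.singleton_injective]

/-- Every vertex of a polygon lies on exactly two edges. -/
lemma card_edges_through_vertex {V : Finset E} (hV : ∀ v ∈ V, IsVertexFace V {v})
    (hrk : vertexRank V = 3) {v : E} (hv : v ∈ V) :
    (((polytopeFaces V).below V 2).filter fun e => v ∈ e).card = 2 := by
  have hss : ({v} : Finset E) ⊂ V := (Finset.singleton_subset_iff.2 hv).ssubset_of_ne fun h => by
    rw [← h, vertexRank_singleton] at hrk; omega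
  have hmem : ∀ e, e ∈ ((polytopeFaces V).below V 2).filter (fun e => v ∈ e) ↔
      IsVertexFace V e ∧ vertexRank e = 2 ∧ v ∈ e := by
    intro e
    simp only [Finset.mem_filter, FaceSystem.mem_below, mem_polytopeFaces, polytopeFaces_rk]
    exact ⟨fun h => ⟨h.1.1, h.1.2.2, h.2⟩, fun h => ⟨⟨h.1, h.1.1, h.2.1⟩, h.2.2⟩⟩
  refine le_antisymm (not_lt.1 fun h => ?_) ?_
  · obtain ⟨a, b, c, ha, hb, hc, hab, hac, hbc⟩ := Finset.two_lt_card_iff.1 h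
    rw [hmem] at ha hb hc
    have h1 : ∀ e, vertexRank e = 2 → v ∈ e → ({v} : Finset E) ⊂ e := fun e he hve =>
      (Finset.singleton_subset_iff.2 hve).ssubset_of_ne fun h' => by
        rw [← h', vertexRank_singleton] at he; omega
    have h2 : ∀ e, IsVertexFace V e → vertexRank e = 2 → e ⊂ V := fun e he hr =>
      he.1.ssubset_of_ne fun h' => by rw [h'] at hr; omega
    exact (isVertexFace_self V).not_three_between (hV v hv) (by rw [hrk, vertexRank_singleton])
      ha.1 hb.1 hc.1 (h1 a ha.2.1 ha.2.2) (h1 b hb.2.1 hb.2.2) (h1 c hc.2.1 hc.2.2)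
      (h2 a ha.1 ha.2.1) (h2 b hb.1 hb.2.1) (h2 c hc.1 hc.2.1) hab hac hbc
  · obtain ⟨w, hw, hwv⟩ := Finset.exists_of_ssubset hss
    obtain ⟨H, hH, hvH, -, hwH, hrH⟩ := (isVertexFace_self V).exists_facet (hV v hv) hss.1 hw hwv
    obtain ⟨u, huH, huv⟩ : ∃ u ∈ H, u ∉ ({v} : Finset E) := by
      refine Finset.exists_of_ssubset (hvH.ssubset_of_ne fun h => ?_)
      rw [← h, vertexRank_singleton] at hrH
      omega
    obtain ⟨H', hH', hvH', -, huH', hrH'⟩ :=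
      (isVertexFace_self V).exists_facet (hV v hv) hss.1 (hH.1 huH) huv
    refine Finset.one_lt_card.2 ⟨H, (hmem H).2 ⟨hH, by omega, ?_⟩, H', (hmem H').2
      ⟨hH', by omega, ?_⟩, fun h => huH' (h ▸ huH)⟩
    exacts [Finset.singleton_subset_iff.1 hvH, Finset.singleton_subset_iff.1 hvH']

/-- A polygon has as many edges as vertices, by counting incident pairs twice. -/
lemma card_edges_eq_card_vertices {V : Finset E} (hV : ∀ v ∈ V, IsVertexFace V {v})
    (hrk : vertexRank V = 3) : ((polytopeFaces V).below V 2).card = V.card := by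
  have h := Finset.sum_card_bipartiteAbove_eq_sum_card_bipartiteBelow (s := V)
    (t := (polytopeFaces V).below V 2) (fun v e => v ∈ e)
  simp only [Finset.bipartiteAbove, Finset.bipartiteBelow] at h
  have he : ∀ e ∈ (polytopeFaces V).below V 2, (V.filter fun v => v ∈ e).card = 2 := by
    intro e he
    simp only [FaceSystem.mem_below, mem_polytopeFaces, polytopeFaces_rk] at he
    rw [Finset.filter_mem_eq_inter, Finset.inter_eq_right.2 he.2.1]
    exact card_eq_two_of_vertexRank_eq_two hV he.1 he.2.2
  rw [Finset.sum_congr rfl fun v hv => card_edges_through_vertex hV hrk hv,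
    Finset.sum_congr rfl he, Finset.sum_const, Finset.sum_const, smul_eq_mul, smul_eq_mul] at h
  omega

theorem hasPyramidCounts_polygon {V : Finset E} (hV : ∀ v ∈ V, IsVertexFace V {v})
    (hrk : vertexRank V = 3) : (polytopeFaces V).HasPyramidCounts := by
  have hcard : ∀ F, IsVertexFace V F → F.card = vertexRank F ∨ F = V := by
    intro F hF
    by_cases h : F = V
    · exact Or.inr h
    have h3 := hF.vertexRank_lt subset_rfl (hF.1.ssubset_of_ne h)
    left
    obtain h | h | h : vertexRank F = 0 ∨ vertexRank F = 1 ∨ vertexRank F = 2 := by omega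
    · rcases F.eq_empty_or_nonempty with rfl | hne
      · simp
      · have := vertexRank_pos hne; omega
    · obtain ⟨v, rfl⟩ := eq_singleton_of_vertexRank_eq_one hV hF h
      rw [h, Finset.card_singleton]
    · rw [h, card_eq_two_of_vertexRank_eq_two hV hF h]
  have hle := vertexRank_le_card V
  refine ⟨fun {F} hF => ?_, fun {F} hF k => ?_, fun {F} hF k => ?_⟩
  · rcases hcard F (mem_polytopeFaces.1 hF) with h | rfl
    · exact Or.inl h
    · exact Or.inr hrk.ge
  · have hF' := mem_polytopeFaces.1 hF
    rcases lt_trichotomy (vertexRank F) (k + 1) with h | h | h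
    · rw [FaceSystem.below_eq_empty hF h, Finset.card_empty, polytopeFaces_rk,
        Nat.choose_eq_zero_of_lt h]
      rcases hcard F hF' with h1 | rfl
      · simp [h1]
      · rw [Nat.choose_eq_zero_of_lt (by omega), mul_zero, add_zero]
    · rw [show k + 1 = (polytopeFaces V).rk F from h.symm, FaceSystem.below_rk_self hF,
        Finset.card_singleton, Nat.choose_self, polytopeFaces_rk]
      rcases hcard F hF' with h1 | rfl
      · simp [h1]
      · rw [Nat.choose_eq_zero_of_lt (by omega), mul_zero, add_zero]
    · rcases hcard F hF' with h1 | rfl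
      · have h3 : vertexRank F ≤ 3 := hrk ▸ FaceSystem.rk_mono (S := polytopeFaces V)
          (polytopeFaces V).top_mem hF hF'.1
        rw [polytopeFaces_rk, h1, Nat.sub_self, zero_mul, add_zero]
        by_cases h4 : F = V
        · subst h4
          obtain rfl | rfl : k = 0 ∨ k = 1 := by omega
          · rw [card_below_one hV subset_rfl, h1, hrk]; rfl
          · rw [card_edges_eq_card_vertices hV hrk, h1, hrk]; rfl
        · have := hF'.vertexRank_lt subset_rfl (hF'.1.ssubset_of_ne h4)
          obtain rfl : k = 0 := by omega
          rw [card_below_one hV hF'.1, h1]; simp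
      · obtain rfl | rfl : k = 0 ∨ k = 1 := by omega
        · rw [card_below_one hV subset_rfl, polytopeFaces_rk, hrk]
          simp; omega
        · rw [card_edges_eq_card_vertices hV hrk, polytopeFaces_rk, hrk]
          simp [Nat.choose]; omega
  · have hF' := mem_polytopeFaces.1 hF
    by_cases h4 : F = V
    · subst h4
      rw [polytopeFaces_rk, hrk]
      rcases Nat.eq_zero_or_pos k with rfl | hk
      · rw [show 0 + 3 = (polytopeFaces F).rk F from hrk.symm, FaceSystem.below_rk_self hF]
        simp [hrk]
      · rw [FaceSystem.below_eq_empty hF (by rw [polytopeFaces_rk]; omega), Finset.sum_empty,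
          Nat.choose_eq_zero_of_lt (by omega), mul_zero]
    · have := hF'.vertexRank_lt subset_rfl (hF'.1.ssubset_of_ne h4)
      rw [FaceSystem.below_eq_empty hF (by rw [polytopeFaces_rk]; omega), Finset.sum_empty,
        polytopeFaces_rk, (hcard F hF').resolve_right h4, Nat.sub_self, zero_mul]

end Polygons

/-! ### Pyramids -/

section Pyramids

open scoped Classical

variable {E : Type*} [NormedAddCommGroup E] [NormedSpace ℝ E]

lemma homogenize_notMem_homSpan {V : Finset E} {a : E} (ha : a ∉ affineSpan ℝ (V : Set E)) :
    homogenize a ∉ homSpan V := by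
  intro h
  rcases V.eq_empty_or_nonempty with rfl | ⟨p, hp⟩
  · simp [homSpan, homogenize] at h
  rw [homSpan_eq_sup hp, Submodule.mem_sup] at h
  obtain ⟨y, hy, z, hz, hsum⟩ := h
  obtain ⟨c, rfl⟩ := Submodule.mem_span_singleton.1 hy
  obtain ⟨w, hw, rfl⟩ := hz
  have h1 : c = 1 := by simpa [homogenize] using congrArg Prod.snd hsum
  have h2 : p + w = a := by simpa [homogenize, h1] using congrArg Prod.fst hsum
  refine ha ?_
  rw [← h2, add_comm]
  exact AffineSubspace.vadd_mem_of_mem_direction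
    (by rwa [direction_affineSpan]) (mem_affineSpan ℝ hp)

/-- The faces of a pyramid are the faces of its base, each with or without the apex. -/
lemma isVertexFace_insert_iff {V F : Finset E} {a : E} (ha : a ∉ affineSpan ℝ (V : Set E)) :
    IsVertexFace (insert a V) F ↔ IsVertexFace V (F.erase a) := by
  have haV : a ∉ V := fun h => ha (mem_affineSpan ℝ h)
  constructor
  · rintro ⟨hF, f, hf, hf0⟩
    refine ⟨by rwa [← Finset.subset_insert_iff], f,
      fun v hv => hf v (Finset.mem_insert_of_mem hv), fun v hv => ?_⟩
    rw [hf0 v (Finset.mem_insert_of_mem hv), Finset.mem_erase]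
    exact (and_iff_right (ne_of_mem_of_not_mem hv haV)).symm
  · rintro ⟨hF, f, hf, hf0⟩
    obtain ⟨h, hha, hh⟩ := Submodule.exists_le_ker_of_notMem (homogenize_notMem_homSpan ha)
    have hV0 : ∀ v ∈ V, h (homogenize v) = 0 := fun v hv => hh (homogenize_mem_homSpan hv)
    -- The value at the apex can be prescribed without changing the values on the base.
    obtain ⟨c, hc0, hc⟩ : ∃ c : ℝ, 0 ≤ c ∧ (c = 0 ↔ a ∈ F) := by
      by_cases haF : a ∈ F
      · exact ⟨0, le_rfl, by simp [haF]⟩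
      · exact ⟨1, zero_le_one, by simp [haF]⟩
    let g := f + ((c - f (homogenize a)) / h (homogenize a)) • h
    have hga : g (homogenize a) = c := by
      simp only [g, LinearMap.add_apply, LinearMap.smul_apply, smul_eq_mul]
      rw [div_mul_cancel₀ _ hha]; ring
    have hgV : ∀ v ∈ V, g (homogenize v) = f (homogenize v) := fun v hv => by
      simp [g, hV0 v hv]
    refine ⟨by rwa [Finset.subset_insert_iff], g, fun v hv => ?_, fun v hv => ?_⟩
    · rcases Finset.mem_insert.1 hv with rfl | hv
      · rwa [hga]
      · rw [hgV v hv]; exact hf v hv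
    · rcases Finset.mem_insert.1 hv with rfl | hv
      · rw [hga, hc]
      · rw [hgV v hv, hf0 v hv, Finset.mem_erase]
        exact and_iff_right (ne_of_mem_of_not_mem hv haV)

lemma vertexRank_insert {V F : Finset E} {a : E} (ha : a ∉ affineSpan ℝ (V : Set E))
    (hF : F ⊆ V) : vertexRank (insert a F) = vertexRank F + 1 := by
  refine le_antisymm (vertexRank_insert_le a F) ?_
  refine Submodule.finrank_lt_finrank_of_lt (lt_of_le_of_ne (homSpan_mono
    (Finset.subset_insert _ _)) fun h => homogenize_notMem_homSpan ha ?_)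
  exact homSpan_mono hF (h ▸ homogenize_mem_homSpan (Finset.mem_insert_self a F))

lemma below_insert_of_notMem {V F : Finset E} {a : E} (ha : a ∉ affineSpan ℝ (V : Set E))
    (haF : a ∉ F) (k : ℕ) :
    (polytopeFaces (insert a V)).below F k = (polytopeFaces V).below F k := by
  ext G
  simp only [FaceSystem.mem_below, mem_polytopeFaces, polytopeFaces_rk,
    isVertexFace_insert_iff ha]
  refine and_congr_left fun h => ?_
  rw [Finset.erase_eq_of_notMem fun h' => haF (h.1 h')]

lemma below_insert {V F : Finset E} {a : E} (ha : a ∉ affineSpan ℝ (V : Set E))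
    (hF : F ⊆ V) (k : ℕ) :
    (polytopeFaces (insert a V)).below (insert a F) (k + 1) =
      (polytopeFaces V).below F (k + 1) ∪ ((polytopeFaces V).below F k).image (insert a) := by
  have haV : a ∉ V := fun h => ha (mem_affineSpan ℝ h)
  have haF : a ∉ F := fun h => haV (hF h)
  ext G
  simp only [FaceSystem.mem_below, mem_polytopeFaces, polytopeFaces_rk,
    isVertexFace_insert_iff ha, Finset.mem_union, Finset.mem_image]
  constructor
  · rintro ⟨hG, hGF, hrk⟩
    by_cases haG : a ∈ G
    · refine Or.inr ⟨G.erase a, ⟨hG, by rwa [← Finset.subset_insert_iff], ?_⟩,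
        Finset.insert_erase haG⟩
      have := vertexRank_insert ha hG.1
      rw [Finset.insert_erase haG] at this
      omega
    · rw [Finset.erase_eq_of_notMem haG] at hG
      exact Or.inl ⟨hG, (Finset.subset_insert_iff_of_notMem haG).1 hGF, hrk⟩
  · rintro (⟨hG, hGF, hrk⟩ | ⟨G, ⟨hG, hGF, hrk⟩, rfl⟩)
    · rw [Finset.erase_eq_of_notMem fun h => haF (hGF h)]
      exact ⟨hG, hGF.trans (Finset.subset_insert _ _), hrk⟩
    · rw [Finset.erase_insert fun h => haF (hGF h), vertexRank_insert ha hG.1, hrk]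
      exact ⟨hG, Finset.insert_subset_insert _ hGF, rfl⟩

lemma sum_below_insert {V F : Finset E} {a : E} (ha : a ∉ affineSpan ℝ (V : Set E))
    (hF : F ⊆ V) (k : ℕ) (c : Finset E → ℕ) :
    ∑ G ∈ (polytopeFaces (insert a V)).below (insert a F) (k + 1), c G =
      ∑ G ∈ (polytopeFaces V).below F (k + 1), c G +
        ∑ G ∈ (polytopeFaces V).below F k, c (insert a G) := by
  have haF : a ∉ F := fun h => ha (mem_affineSpan ℝ (hF h))
  have hsub : ∀ {j G}, G ∈ (polytopeFaces V).below F j → a ∉ G := fun hG h =>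
    haF ((FaceSystem.mem_below.1 hG).2.1 h)
  rw [below_insert ha hF, Finset.sum_union, Finset.sum_image]
  · intro G hG G' hG' h
    rw [← Finset.erase_insert (hsub hG), ← Finset.erase_insert (hsub hG')]
    exact congrArg (Finset.erase · a) h
  · rw [Finset.disjoint_left]
    intro G hG hG'
    obtain ⟨G', -, rfl⟩ := Finset.mem_image.1 hG'
    exact hsub hG (Finset.mem_insert_self _ _)

/-- Passing to a pyramid turns the face counts into Pascal sums and leaves the excess unchanged. -/
theorem hasPyramidCounts_insert {V : Finset E} {a : E} (ha : a ∉ affineSpan ℝ (V : Set E))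
    (hV : (polytopeFaces V).HasPyramidCounts) :
    (polytopeFaces (insert a V)).HasPyramidCounts := by
  have haV : a ∉ V := fun h => ha (mem_affineSpan ℝ h)
  -- A face of the pyramid is a face of the base or the pyramid over one.
  have cases : ∀ F ∈ (polytopeFaces (insert a V)).faces, (a ∉ F ∧ F ∈ (polytopeFaces V).faces) ∨
      ∃ G ∈ (polytopeFaces V).faces, a ∉ G ∧ F = insert a G := by
    intro F hF
    rw [mem_polytopeFaces, isVertexFace_insert_iff ha] at hF
    by_cases haF : a ∈ F
    · exact Or.inr ⟨F.erase a, mem_polytopeFaces.2 hF, by simp, (Finset.insert_erase haF).symm⟩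
    · rw [Finset.erase_eq_of_notMem haF] at hF
      exact Or.inl ⟨haF, mem_polytopeFaces.2 hF⟩
  refine ⟨fun {F} hF => ?_, fun {F} hF k => ?_, fun {F} hF k => ?_⟩
  · rcases cases F hF with ⟨-, h⟩ | ⟨G, hG, haG, rfl⟩
    · exact hV.card_eq_or h
    · have := hV.card_eq_or hG
      simp only [polytopeFaces_rk] at *
      rw [Finset.card_insert_of_notMem haG,
        vertexRank_insert ha (mem_polytopeFaces.1 hG).1]
      omega
  · rcases cases F hF with ⟨haF, h⟩ | ⟨G, hG, haG, rfl⟩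
    · rw [below_insert_of_notMem ha haF]
      exact hV.card_below h k
    · have hGV := (mem_polytopeFaces.1 hG).1
      have h1 := hV.card_below hG k
      have h3 := hV.card_eq_or hG
      simp only [polytopeFaces_rk] at *
      have h2 := sum_below_insert ha hGV k fun _ => 1
      simp only [Finset.sum_const, smul_eq_mul, mul_one] at h2
      rw [h2, Finset.card_insert_of_notMem haG, vertexRank_insert ha hGV, h1,
        Nat.add_sub_add_right]
      rcases k with _ | k
      · rw [FaceSystem.below_zero]
        simp; omega
      · have h4 := hV.card_below hG k
        simp only [polytopeFaces_rk] at h4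
        rw [h4, Nat.choose_succ_succ (vertexRank G) (k + 1)]
        rcases h3 with h3 | h3
        · rw [h3, Nat.sub_self]; ring
        · rw [show vertexRank G + 1 - 2 = (vertexRank G - 2) + 1 by omega,
            Nat.choose_succ_succ (vertexRank G - 2) k, Nat.succ_eq_add_one]
          ring
  · rcases cases F hF with ⟨haF, h⟩ | ⟨G, hG, haG, rfl⟩
    · rw [below_insert_of_notMem ha haF]
      exact hV.sum_excess h k
    · have hGV := (mem_polytopeFaces.1 hG).1
      have h1 := hV.sum_excess hG k
      have h3 := hV.card_eq_or hG
      simp only [polytopeFaces_rk] at *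
      have hc : ∀ H ∈ (polytopeFaces V).below G (k + 2),
          (insert a H).card - (k + 3) = H.card - (k + 2) := by
        intro H hH
        rw [Finset.card_insert_of_notMem fun h => haG ((FaceSystem.mem_below.1 hH).2.1 h)]
        omega
      rw [sum_below_insert ha hGV (k + 2) fun H => H.card - (k + 3), h1,
        Finset.sum_congr rfl hc, Finset.card_insert_of_notMem haG, vertexRank_insert ha hGV,
        Nat.add_sub_add_right]
      rcases k with _ | k
      · rw [Finset.sum_eq_zero]
        · simp
        · intro H hH
          obtain ⟨h5, -, h6⟩ := FaceSystem.mem_below.1 hH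
          have h7 := hV.card_eq_or h5
          simp only [polytopeFaces_rk] at *
          omega
      · have h4 := hV.sum_excess hG k
        simp only [polytopeFaces_rk] at h4
        rw [h4]
        rcases h3 with h3 | h3
        · rw [h3, Nat.sub_self]; ring
        · rw [show vertexRank G + 1 - 3 = (vertexRank G - 3) + 1 by omega,
            Nat.choose_succ_succ (vertexRank G - 3) k, Nat.succ_eq_add_one]
          ring

lemma IsPolygon.exists_polytopeFaces {m : ℕ} {G : Set E} (hG : IsPolygon m G) :
    ∃ V : Finset E, G = convexHull ℝ (V : Set E) ∧ V.card = m ∧ vertexRank V = 3 ∧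
      (polytopeFaces V).HasPyramidCounts := by
  obtain ⟨V, hcard, rfl, hext, hdim⟩ := hG
  have hne : V.Nonempty := by
    by_contra h
    rw [Finset.not_nonempty_iff_eq_empty.1 h, Finset.coe_empty, convexHull_empty, convexDim,
      vectorSpan_empty, finrank_bot] at hdim
    omega
  have hrk : vertexRank V = 3 := by rw [vertexRank_eq_convexDim hne, hdim]
  exact ⟨V, rfl, hcard, hrk, hasPyramidCounts_polygon
    (fun v hv => isVertexFace_singleton (hext.ge hv)) hrk⟩

lemma IsIteratedPyramid.exists_polytopeFaces {m : ℕ} {G : Set E} (hG : IsPolygon m G) :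
    ∀ {k : ℕ} {Q : Set E}, IsIteratedPyramid G k Q →
      ∃ V : Finset E, Q = convexHull ℝ (V : Set E) ∧ V.card = m + k ∧ vertexRank V = 3 + k ∧
        (polytopeFaces V).HasPyramidCounts
  | 0, Q, hQ => by
    obtain rfl : Q = G := hQ
    exact hG.exists_polytopeFaces
  | k + 1, Q, hQ => by
    obtain ⟨B, a, hB, ha, rfl⟩ := hQ
    obtain ⟨V, rfl, hcard, hrk, hV⟩ := IsIteratedPyramid.exists_polytopeFaces hG hB
    rw [affineSpan_convexHull] at ha
    have haV : a ∉ V := fun h => ha (mem_affineSpan ℝ h)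
    refine ⟨insert a V, ?_, ?_, ?_, hasPyramidCounts_insert ha hV⟩
    · rw [Finset.coe_insert, Set.insert_eq, Set.insert_eq, convexHull_convexHull_union_right]
    · rw [Finset.card_insert_of_notMem haV, hcard]; rfl
    · rw [vertexRank_insert ha subset_rfl, hrk]; rfl

end Pyramids

/-! ### The vertex-facet incidences of multiplexes -/

section MultiplexIncidence

/-- The incidence of vertex `v` and facet `i` in a `d`-dimensional multiplex with vertices
`0, …, n`. The relation is symmetric, so multiplexes are combinatorially self-dual. -/
def MultiplexInc (d n v i : ℕ) : Prop :=
  v < i + d ∧ i < v + d ∧ (v ≠ i ∨ v = 0 ∨ v = n)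

instance (d n v i : ℕ) : Decidable (MultiplexInc d n v i) := by
  unfold MultiplexInc; infer_instance

lemma MultiplexInc.symm {d n v i : ℕ} (h : MultiplexInc d n v i) : MultiplexInc d n i v := by
  unfold MultiplexInc at *; omega

/-- The vertices of the facet `i`. -/
def multiplexVerts (d n i : ℕ) : Finset ℕ :=
  (Finset.range (n + 1)).filter fun v => MultiplexInc d n v i

lemma mem_multiplexVerts {d n i v : ℕ} :
    v ∈ multiplexVerts d n i ↔ v ≤ n ∧ MultiplexInc d n v i := by
  simp [multiplexVerts]

/-- The pairs `(d, n)` occurring as parameters of faces of multiplexes; in dimensions `0` and `1`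
only simplices occur. -/
def MultiplexParams (d n : ℕ) : Prop := d ≤ n ∧ (d ≤ 1 → n = d)

/-- The facet `q` of a `(d + 1)`-dimensional multiplex has vertices `0, …, facetLast d n q` in its
own numbering. -/
def facetLast (d n q : ℕ) : ℕ :=
  if q = 0 ∨ q = n then d else min q d + min (n - q) d - 1

/-- The increasing enumeration of the vertices of the facet `q` of a `(d + 1)`-dimensional
multiplex. -/
def facetEnum (d n q m : ℕ) : ℕ :=
  if q = 0 ∨ q = n ∨ m + (q - d) < q then m + (q - d) else m + (q - d) + 1

/-- The position of `v` in the enumeration `facetEnum`. -/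
def facetPos (d n q v : ℕ) : ℕ :=
  if q = 0 ∨ q = n ∨ v < q then v - (q - d) else v - 1 - (q - d)

/-- The facet `m` of the facet `q` is the intersection of the facets `q` and `ridgeIndex d n q m`
of the ambient `(d + 1)`-dimensional multiplex. -/
def ridgeIndex (d n q m : ℕ) : ℕ :=
  if q = 0 then (if m = d then d + 1 else if m = 0 then d else m)
  else if q = n then (if m = 0 then n - d - 1 else if m = d then n - d else n - d + m)
  else if m = facetLast d n q ∧ q + d + 1 ≤ n then q + d + 1
  else if m = 0 ∧ d + 1 ≤ q then q - d - 1
  else facetEnum d n q m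

/-- A facet of the facet `q` containing the intersection of the facets `q` and `j`. -/
def coverIndex (d n q j : ℕ) : ℕ :=
  if q = 0 then (if d + 1 ≤ j then d else if j = d then 0 else j)
  else if q = n then (if j + d + 1 ≤ n then 0 else if j + d = n then d else j + d - n)
  else if q < j then min (j - 1 - (q - d)) (facetLast d n q)
  else j - (q - d)

variable {d n q : ℕ}

lemma MultiplexParams.facet (h : MultiplexParams (d + 1) n) (hq : q ≤ n) :
    MultiplexParams d (facetLast d n q) := by
  unfold MultiplexParams facetLast at *
  split_ifs <;> omega

lemma facetEnum_mem (h : MultiplexParams (d + 1) n) (hq : q ≤ n) {m : ℕ}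
    (hm : m ≤ facetLast d n q) : facetEnum d n q m ∈ multiplexVerts (d + 1) n q := by
  rw [mem_multiplexVerts]
  unfold MultiplexParams facetLast facetEnum MultiplexInc at *
  split_ifs at * <;> omega

lemma facetPos_facetEnum (h : MultiplexParams (d + 1) n) (hq : q ≤ n) {m : ℕ}
    (hm : m ≤ facetLast d n q) : facetPos d n q (facetEnum d n q m) = m := by
  unfold MultiplexParams facetLast facetEnum facetPos at *
  split_ifs at * <;> omega

lemma facetPos_le (h : MultiplexParams (d + 1) n) (hq : q ≤ n) {v : ℕ}
    (hv : v ∈ multiplexVerts (d + 1) n q) : facetPos d n q v ≤ facetLast d n q := by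
  rw [mem_multiplexVerts] at hv
  unfold MultiplexParams facetLast facetPos MultiplexInc at *
  split_ifs at * <;> omega

lemma facetEnum_facetPos (h : MultiplexParams (d + 1) n) (hq : q ≤ n) {v : ℕ}
    (hv : v ∈ multiplexVerts (d + 1) n q) : facetEnum d n q (facetPos d n q v) = v := by
  rw [mem_multiplexVerts] at hv
  unfold MultiplexParams facetEnum facetPos MultiplexInc at *
  split_ifs at * <;> omega

lemma ridgeIndex_spec (h : MultiplexParams (d + 1) n) (hq : q ≤ n) {m : ℕ}
    (hm : m ≤ facetLast d n q) :
    ridgeIndex d n q m ≤ n ∧ ridgeIndex d n q m ≠ q := by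
  unfold MultiplexParams facetLast ridgeIndex facetLast facetEnum at *
  split_ifs at * <;> omega

lemma inc_facetPos_iff (h : MultiplexParams (d + 1) n) (hq : q ≤ n) {m v : ℕ}
    (hm : m ≤ facetLast d n q) (hv : v ∈ multiplexVerts (d + 1) n q) :
    MultiplexInc d (facetLast d n q) (facetPos d n q v) m ↔
      MultiplexInc (d + 1) n v (ridgeIndex d n q m) := by
  rw [mem_multiplexVerts] at hv
  obtain rfl | hq0 := Nat.eq_zero_or_pos q
  · simp only [MultiplexParams, facetLast, ridgeIndex, facetPos, MultiplexInc, true_or,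
      if_true] at *
    split_ifs <;> omega
  have hq0' : q ≠ 0 := hq0.ne'
  obtain rfl | hqn := hq.eq_or_lt
  · simp only [MultiplexParams, facetLast, ridgeIndex, facetPos, MultiplexInc, hq0', true_or,
      or_true, if_true, if_false] at *
    split_ifs <;> omega
  have hqn' : q ≠ n := hqn.ne
  simp only [MultiplexParams, facetLast, ridgeIndex, facetPos, facetEnum, MultiplexInc, hq0', hqn',
    false_or, if_false] at *
  obtain ⟨e, he⟩ : ∃ e, e = min q d + min (n - q) d - 1 := ⟨_, rfl⟩
  rw [← he] at hm ⊢
  by_cases h1 : m = e ∧ q + d + 1 ≤ n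
  · rw [if_pos h1]
    split_ifs <;> omega
  rw [if_neg h1]
  by_cases h2 : m = 0 ∧ d + 1 ≤ q
  · rw [if_pos h2]
    split_ifs <;> omega
  rw [if_neg h2]
  by_cases h3 : m + (q - d) < q
  · rw [if_pos h3]
    split_ifs <;> omega
  · rw [if_neg h3]
    split_ifs <;> omega

lemma coverIndex_le (h : MultiplexParams (d + 1) n) (hq : q ≤ n) {j : ℕ} (hj : j ≤ n) :
    coverIndex d n q j ≤ facetLast d n q := by
  unfold MultiplexParams facetLast coverIndex facetLast at *
  split_ifs at * <;> omega

lemma inc_coverIndex (h : MultiplexParams (d + 1) n) (hq : q ≤ n) {j v : ℕ} (hj : j ≤ n)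
    (hjq : j ≠ q) (hv : v ∈ multiplexVerts (d + 1) n q) (hvj : MultiplexInc (d + 1) n v j) :
    MultiplexInc d (facetLast d n q) (facetPos d n q v) (coverIndex d n q j) := by
  rw [mem_multiplexVerts] at hv
  unfold MultiplexParams facetLast coverIndex facetLast facetPos MultiplexInc at *
  split_ifs at * <;> omega

/-- The facets `m ≥ min q d` of the facet `q < n` lie in later facets. -/
lemma lt_ridgeIndex (h : MultiplexParams (d + 1) n) (hq : q < n) {m : ℕ}
    (hm : m ≤ facetLast d n q) (hqm : min q d ≤ m) : q < ridgeIndex d n q m := by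
  unfold MultiplexParams facetLast ridgeIndex facetLast facetEnum at *
  split_ifs at * <;> omega

/-- The intersections of the facet `q < n` with later facets lie in its facets `m ≥ min q d`. -/
lemma le_coverIndex (hq : q < n) {j : ℕ} (hqj : q < j) : min q d ≤ coverIndex d n q j := by
  unfold coverIndex facetLast at *
  split_ifs at * <;> omega

/-- No facet is contained in another one. -/
lemma eq_of_multiplexVerts_subset (h : MultiplexParams d n) {i j : ℕ} (hi : i ≤ n) (hj : j ≤ n)
    (hsub : multiplexVerts d n i ⊆ multiplexVerts d n j) : i = j := by
  by_contra hne
  -- a vertex of the facet `i` outside the facet `j`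
  let v := if j = 0 then min n (i + d - 1) else if j = n then i + 1 - d
    else if i < j + d ∧ j < i + d then j else if i < j then i + 1 - d else min n (i + d - 1)
  have hv : v ≤ n ∧ MultiplexInc d n v i ∧ ¬ MultiplexInc d n v j := by
    unfold v MultiplexParams MultiplexInc at *
    split_ifs <;> omega
  exact hv.2.2 (mem_multiplexVerts.1 (hsub (mem_multiplexVerts.2 ⟨hv.1, hv.2.1⟩))).2

end MultiplexIncidence

/-! ### Faces of multiplexes -/

section MultiplexFaces

open scoped Classical

variable {ι : Type*} {S : FaceSystem ι}

/-- The facet `i` of a `d`-dimensional multiplex with vertices `φ 0, …, φ n`. -/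
noncomputable def multiplexFace (φ : ℕ → ι) (d n i : ℕ) : Finset ι := (multiplexVerts d n i).image φ

variable (S) in
/-- The face `F` is a `d`-dimensional multiplex with vertices `φ 0, …, φ n`. -/
structure IsMultiplexFace (d n : ℕ) (φ : ℕ → ι) (F : Finset ι) : Prop where
  params : MultiplexParams d n
  inj : Set.InjOn φ (Set.Iic n)
  eq_image : F = (Finset.range (n + 1)).image φ
  mem : F ∈ S.faces
  rk_eq : S.rk F = d + 1
  facets : ∀ H, (H ∈ S.faces ∧ H ⊆ F ∧ S.rk H = d) ↔ ∃ i ≤ n, H = multiplexFace φ d n i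

namespace IsMultiplexFace

variable {d n q : ℕ} {φ : ℕ → ι} {F : Finset ι}

lemma mem_multiplexFace (hM : IsMultiplexFace S d n φ F) {v i : ℕ} (hv : v ≤ n) :
    φ v ∈ multiplexFace φ d n i ↔ MultiplexInc d n v i := by
  rw [multiplexFace, Finset.mem_image]
  constructor
  · rintro ⟨w, hw, h⟩
    rw [mem_multiplexVerts] at hw
    exact hM.inj hw.1 hv h ▸ hw.2
  · exact fun h => ⟨v, mem_multiplexVerts.2 ⟨hv, h⟩, rfl⟩

lemma mem_iff (hM : IsMultiplexFace S d n φ F) {w : ι} : w ∈ F ↔ ∃ v ≤ n, φ v = w := by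
  rw [hM.eq_image, Finset.mem_image]
  simp

lemma multiplexFace_spec (hM : IsMultiplexFace S d n φ F) {i : ℕ} (hi : i ≤ n) :
    multiplexFace φ d n i ∈ S.faces ∧ multiplexFace φ d n i ⊆ F ∧
      S.rk (multiplexFace φ d n i) = d :=
  (hM.facets _).2 ⟨i, hi, rfl⟩

lemma eq_of_multiplexFace_subset (hM : IsMultiplexFace S d n φ F) {i j : ℕ} (hi : i ≤ n)
    (hj : j ≤ n) (h : multiplexFace φ d n i ⊆ multiplexFace φ d n j) : i = j := by
  refine eq_of_multiplexVerts_subset hM.params hi hj fun v hv => ?_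
  have hv' := mem_multiplexVerts.1 hv
  exact mem_multiplexVerts.2 ⟨hv'.1, (hM.mem_multiplexFace hv'.1).1
    (h ((hM.mem_multiplexFace hv'.1).2 hv'.2))⟩

lemma card_eq (hM : IsMultiplexFace S d n φ F) : F.card = n + 1 := by
  rw [hM.eq_image, Finset.card_image_of_injOn, Finset.card_range]
  intro a ha b hb h
  simp only [Finset.coe_range, Set.mem_Iio, Nat.lt_succ_iff] at ha hb
  exact hM.inj ha hb h

/-- Proper faces are separated by facets from the points outside them. -/
lemma exists_multiplexFace (hM : IsMultiplexFace S d n φ F) {G : Finset ι} (hG : G ∈ S.faces)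
    (hGF : G ⊆ F) {v : ι} (hv : v ∈ F) (hvG : v ∉ G) :
    ∃ i ≤ n, G ⊆ multiplexFace φ d n i ∧ v ∉ multiplexFace φ d n i := by
  obtain ⟨H, hH, hGH, hHF, hvH, hrk⟩ := S.exists_facet hM.mem hG hGF hv hvG
  rw [hM.rk_eq] at hrk
  obtain ⟨i, hi, rfl⟩ := (hM.facets H).1 ⟨hH, hHF, by omega⟩
  exact ⟨i, hi, hGH, hvH⟩

lemma exists_multiplexFace_of_rk_lt (hM : IsMultiplexFace S d n φ F) {G : Finset ι}
    (hG : G ∈ S.faces) (hGF : G ⊆ F) (hrk : S.rk G < d + 1) :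
    ∃ i ≤ n, G ⊆ multiplexFace φ d n i := by
  obtain ⟨v, hv, hvG⟩ := Finset.exists_of_ssubset
    (FaceSystem.ssubset_of_rk_lt (S := S) hGF (hM.rk_eq ▸ hrk))
  obtain ⟨i, hi, h, -⟩ := hM.exists_multiplexFace hG hGF hv hvG
  exact ⟨i, hi, h⟩

lemma multiplexFace_comp_facetEnum (hM : IsMultiplexFace S (d + 1) n φ F) (hq : q ≤ n) {m : ℕ}
    (hm : m ≤ facetLast d n q) :
    multiplexFace (φ ∘ facetEnum d n q) d (facetLast d n q) m =
      multiplexFace φ (d + 1) n q ∩ multiplexFace φ (d + 1) n (ridgeIndex d n q m) := by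
  ext w
  rw [Finset.mem_inter]
  constructor
  · intro hw
    obtain ⟨v, hv, rfl⟩ := Finset.mem_image.1 hw
    rw [mem_multiplexVerts] at hv
    have h1 := facetEnum_mem hM.params hq hv.1
    have h2 := (inc_facetPos_iff hM.params hq hm h1).1
      ((facetPos_facetEnum hM.params hq hv.1).symm ▸ hv.2)
    have h3 := mem_multiplexVerts.1 h1
    exact ⟨Finset.mem_image_of_mem φ h1, (hM.mem_multiplexFace h3.1).2 h2⟩
  · rintro ⟨hw, hw'⟩
    obtain ⟨v, hv, rfl⟩ := Finset.mem_image.1 hw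
    have h1 := mem_multiplexVerts.1 hv
    rw [hM.mem_multiplexFace h1.1, ← inc_facetPos_iff hM.params hq hm hv] at hw'
    refine Finset.mem_image.2 ⟨facetPos d n q v,
      mem_multiplexVerts.2 ⟨facetPos_le hM.params hq hv, hw'⟩, ?_⟩
    rw [Function.comp_apply, facetEnum_facetPos hM.params hq hv]

lemma inter_subset_coverIndex (hM : IsMultiplexFace S (d + 1) n φ F) (hq : q ≤ n) {j : ℕ}
    (hj : j ≤ n) (hjq : j ≠ q) :
    multiplexFace φ (d + 1) n q ∩ multiplexFace φ (d + 1) n j ⊆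
      multiplexFace (φ ∘ facetEnum d n q) d (facetLast d n q) (coverIndex d n q j) := by
  intro w hw
  obtain ⟨hw, hw'⟩ := Finset.mem_inter.1 hw
  obtain ⟨v, hv, rfl⟩ := Finset.mem_image.1 hw
  rw [hM.mem_multiplexFace (mem_multiplexVerts.1 hv).1] at hw'
  refine Finset.mem_image.2 ⟨facetPos d n q v, mem_multiplexVerts.2
    ⟨facetPos_le hM.params hq hv, inc_coverIndex hM.params hq hj hjq hv hw'⟩, ?_⟩
  rw [Function.comp_apply, facetEnum_facetPos hM.params hq hv]

/-- The facets of a multiplex are multiplexes: a facet of the facet `q` is a maximal intersection of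
the facet `q` with another facet. -/
lemma facet (hM : IsMultiplexFace S (d + 1) n φ F) (hq : q ≤ n) :
    IsMultiplexFace S d (facetLast d n q) (φ ∘ facetEnum d n q)
      (multiplexFace φ (d + 1) n q) := by
  have hp := hM.params
  obtain ⟨hqf, hqF, hqrk⟩ := hM.multiplexFace_spec hq
  have hle : ∀ {m}, m ≤ facetLast d n q → facetEnum d n q m ≤ n := fun hm =>
    (mem_multiplexVerts.1 (facetEnum_mem hp hq hm)).1
  have hinj : Set.InjOn (φ ∘ facetEnum d n q) (Set.Iic (facetLast d n q)) := by
    intro a ha b hb h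
    rw [← facetPos_facetEnum hp hq ha, ← facetPos_facetEnum hp hq hb,
      hM.inj (hle ha) (hle hb) h]
  have hmem : ∀ {m}, m ≤ facetLast d n q →
      multiplexFace (φ ∘ facetEnum d n q) d (facetLast d n q) m ∈ S.faces ∧
      multiplexFace (φ ∘ facetEnum d n q) d (facetLast d n q) m ⊂
        multiplexFace φ (d + 1) n q := by
    intro m hm
    obtain ⟨h1, h2⟩ := ridgeIndex_spec hp hq hm
    rw [hM.multiplexFace_comp_facetEnum hq hm]
    refine ⟨S.inter_mem hqf (hM.multiplexFace_spec h1).1,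
      Finset.inter_subset_left.ssubset_of_ne fun h => ?_⟩
    exact h2 (hM.eq_of_multiplexFace_subset hq h1 (Finset.inter_eq_left.1 h)).symm
  have hto : ∀ H, (H ∈ S.faces ∧ H ⊆ multiplexFace φ (d + 1) n q ∧ S.rk H = d) →
      ∃ m ≤ facetLast d n q,
        H = multiplexFace (φ ∘ facetEnum d n q) d (facetLast d n q) m := by
    rintro H ⟨hH, hHq, hrk⟩
    obtain ⟨v, hv, hvH⟩ := Finset.exists_of_ssubset
      (FaceSystem.ssubset_of_rk_lt (S := S) hHq (by omega))
    obtain ⟨j, hj, hHj, hvj⟩ := hM.exists_multiplexFace hH (hHq.trans hqF) (hqF hv) hvH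
    have hjq : j ≠ q := by
      rintro rfl; exact hvj hv
    have hc := coverIndex_le hp hq hj
    obtain ⟨h1, h2⟩ := hmem hc
    have h3 := S.rk_lt hqf h1 h2
    exact ⟨_, hc, FaceSystem.eq_of_subset_of_rk_le h1 hH
      ((Finset.subset_inter hHq hHj).trans (hM.inter_subset_coverIndex hq hj hjq)) (by omega)⟩
  refine ⟨hp.facet hq, hinj, ?_, hqf, hqrk, fun H => ⟨hto H, ?_⟩⟩
  · ext w
    simp only [multiplexFace, Finset.mem_image, Finset.mem_range, Nat.lt_succ_iff,
      Function.comp_apply]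
    constructor
    · rintro ⟨v, hv, rfl⟩
      exact ⟨facetPos d n q v, facetPos_le hp hq hv, by rw [facetEnum_facetPos hp hq hv]⟩
    · rintro ⟨m, hm, rfl⟩
      exact ⟨_, facetEnum_mem hp hq hm, rfl⟩
  · rintro ⟨m, hm, rfl⟩
    obtain ⟨h1, h2⟩ := hmem hm
    refine ⟨h1, h2.1, ?_⟩
    obtain ⟨v, hv, hvm⟩ := Finset.exists_of_ssubset h2
    obtain ⟨H, hH, hsub, hHq, -, hrk⟩ := S.exists_facet hqf h1 h2.1 hv hvm
    obtain ⟨m', hm', rfl⟩ := hto H ⟨hH, hHq, by omega⟩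
    have hmm : m = m' := by
      refine eq_of_multiplexVerts_subset (hp.facet hq) hm hm' fun w hw => ?_
      obtain ⟨u, hu, he⟩ := Finset.mem_image.1 (hsub (Finset.mem_image_of_mem _ hw))
      exact hinj (mem_multiplexVerts.1 hu).1 (mem_multiplexVerts.1 hw).1 he ▸ hu
    rw [hmm]
    omega

/-- Every nonempty face of a multiplex is a multiplex. -/
lemma exists_isMultiplexFace : ∀ {d n : ℕ} {φ : ℕ → ι} {F : Finset ι},
    IsMultiplexFace S d n φ F → ∀ {G : Finset ι}, G ∈ S.faces → G ⊆ F → G.Nonempty →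
      ∃ d' n' φ', IsMultiplexFace S d' n' φ' G
  | d, n, φ, F, hM, G, hG, hGF, hne => by
    rcases hGF.eq_or_ssubset with rfl | hlt
    · exact ⟨d, n, φ, hM⟩
    · have hrk := S.rk_lt hM.mem hG hlt
      rw [hM.rk_eq] at hrk
      obtain ⟨i, hi, hGi⟩ := hM.exists_multiplexFace_of_rk_lt hG hGF hrk
      cases d with
      | zero =>
        rw [FaceSystem.eq_empty_of_rk_eq_zero hG (by omega)] at hne
        exact absurd hne Finset.not_nonempty_empty
      | succ d => exact exists_isMultiplexFace (hM.facet hi) hG hGi hne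

end IsMultiplexFace

end MultiplexFaces

/-! ### The number of faces of a multiplex -/

section MultiplexCounts

open scoped Classical

lemma sum_range_choose_eq (t r : ℕ) : ∑ m ∈ Finset.range t, m.choose r = t.choose (r + 1) := by
  induction t with
  | zero => simp
  | succ t ih => rw [Finset.sum_range_succ, ih, Nat.choose_succ_succ, add_comm]

/-- Counting the elements of `X` by the last index `m < t` at which `P` holds. -/
lemma card_eq_sum_card_last {α : Type*} (X : Finset α) (P : ℕ → α → Prop) (t : ℕ)
    (h : ∀ x ∈ X, ∃ m < t, P m x) :
    X.card = ∑ m ∈ Finset.range t,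
      (X.filter fun x => P m x ∧ ∀ m' < t, m < m' → ¬ P m' x).card := by
  rw [← Finset.card_biUnion]
  · congr 1
    ext x
    simp only [Finset.mem_biUnion, Finset.mem_range, Finset.mem_filter]
    constructor
    · intro hx
      obtain ⟨m, hm, hmax⟩ := Finset.exists_max_image ((Finset.range t).filter fun m => P m x) id
        (by obtain ⟨m, hm, hP⟩ := h x hx; exact ⟨m, by simp [hm, hP]⟩)
      simp only [Finset.mem_filter, Finset.mem_range, id] at hm hmax
      exact ⟨m, hm.1, hx, hm.2, fun m' hm' hlt hP => absurd (hmax m' ⟨hm', hP⟩) (by omega)⟩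
    · rintro ⟨m, -, hx, -⟩
      exact hx
  · intro m hm m' hm' hne
    rw [Function.onFun, Finset.disjoint_left]
    intro x hx hx'
    simp only [Finset.mem_filter, Finset.coe_range, Set.mem_Iio] at *
    rcases lt_or_gt_of_ne hne with hlt | hlt
    · exact hx.2.2 m' hm' hlt hx'.2.1
    · exact hx'.2.2 m hm hlt hx.2.1

variable {ι : Type*} {S : FaceSystem ι}

namespace IsMultiplexFace

/-- The number of faces of rank `k` whose last facet is `q < n`. The facets `m < min q d` of the
facet `q` are exactly those not contained in a later facet of the multiplex, so the count is a sum
of such counts for the facet `q`. -/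
lemma card_last_facet : ∀ {d n : ℕ} {φ : ℕ → ι} {F : Finset ι},
    IsMultiplexFace S (d + 1) n φ F → ∀ {q k : ℕ}, q < n → k ≤ d + 1 →
      ((S.below (multiplexFace φ (d + 1) n q) k).filter fun G =>
        ∀ i ≤ n, q < i → ¬ G ⊆ multiplexFace φ (d + 1) n i).card =
          (min q d).choose (d + 1 - k)
  | d, n, φ, F, hM, q, k, hq, hk => by
    obtain ⟨hqf, hqF, hqrk⟩ := hM.multiplexFace_spec hq.le
    rcases hk.eq_or_lt with rfl | hk
    · have h1 := FaceSystem.below_rk_self hqf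
      rw [hqrk] at h1
      rw [h1, Finset.filter_singleton, if_pos, Finset.card_singleton, Nat.sub_self,
        Nat.choose_zero_right]
      intro i hi hqi h
      have := hM.eq_of_multiplexFace_subset hq.le hi h
      omega
    have hM' := hM.facet hq.le
    have hN : min q d = 0 ∨ min q d ≤ facetLast d n q := by
      unfold facetLast
      split_ifs <;> omega
    obtain ⟨X, hX⟩ : ∃ X, X = (S.below (multiplexFace φ (d + 1) n q) k).filter fun G =>
        ∀ i ≤ n, q < i → ¬ G ⊆ multiplexFace φ (d + 1) n i := ⟨_, rfl⟩
    have hmemX : ∀ G, G ∈ X ↔ (G ∈ S.faces ∧ G ⊆ multiplexFace φ (d + 1) n q ∧ S.rk G = k) ∧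
        ∀ i ≤ n, q < i → ¬ G ⊆ multiplexFace φ (d + 1) n i := by
      intro G; rw [hX, Finset.mem_filter, FaceSystem.mem_below]
    have hlate : ∀ G ∈ X, ∀ m ≤ facetLast d n q, min q d ≤ m →
        ¬ G ⊆ multiplexFace (φ ∘ facetEnum d n q) d (facetLast d n q) m := by
      intro G hG m hm hqm h
      rw [hM.multiplexFace_comp_facetEnum hq.le hm] at h
      exact ((hmemX G).1 hG).2 _ (ridgeIndex_spec hM.params hq.le hm).1
        (lt_ridgeIndex hM.params hq hm hqm) (h.trans Finset.inter_subset_right)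
    rw [← hX, card_eq_sum_card_last X (fun m G => G ⊆ multiplexFace (φ ∘ facetEnum d n q) d
      (facetLast d n q) m) (min q d)]
    · have hterm : ∀ m ∈ Finset.range (min q d),
          (X.filter fun G => G ⊆ multiplexFace (φ ∘ facetEnum d n q) d (facetLast d n q) m ∧
            ∀ m' < min q d, m < m' →
              ¬ G ⊆ multiplexFace (φ ∘ facetEnum d n q) d (facetLast d n q) m').card =
          m.choose (d - k) := by
        intro m hm
        rw [Finset.mem_range] at hm
        obtain ⟨d, rfl⟩ : ∃ d', d = d' + 1 := ⟨d - 1, by omega⟩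
        have hmN : m < facetLast (d + 1) n q := by omega
        rw [show m.choose (d + 1 - k) = (min m d).choose (d + 1 - k) by
          rw [min_eq_left (by omega)], ← card_last_facet hM' hmN (by omega)]
        congr 1
        ext G
        simp only [Finset.mem_filter, FaceSystem.mem_below]
        constructor
        · rintro ⟨hG, hGm, hlast⟩
          obtain ⟨⟨hG1, hG2, hG3⟩, hG4⟩ := (hmemX G).1 hG
          refine ⟨⟨hG1, hGm, hG3⟩, fun i hi hmi => ?_⟩
          rcases lt_or_ge i (min q (d + 1)) with h | h
          · exact hlast i h hmi
          · exact hlate G hG i hi h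
        · rintro ⟨⟨hG1, hGm, hG3⟩, hlast⟩
          refine ⟨(hmemX G).2 ⟨⟨hG1, hGm.trans (hM'.multiplexFace_spec hmN.le).2.1, hG3⟩,
            fun i hi hqi h => ?_⟩, hGm, fun m' hm' hmm' => hlast m' (by omega) hmm'⟩
          exact hlast _ (coverIndex_le hM.params hq.le hi)
            (hm.trans_le (le_coverIndex hq hqi))
            ((Finset.subset_inter (hGm.trans (hM'.multiplexFace_spec hmN.le).2.1) h).trans
              (hM.inter_subset_coverIndex hq.le hi hqi.ne'))
      have hsum := (Finset.sum_congr rfl hterm).trans (sum_range_choose_eq (min q d) (d - k))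
      rw [show d + 1 - k = d - k + 1 by omega]
      convert hsum
    · intro G hG
      obtain ⟨⟨hG1, hG2, hG3⟩, -⟩ := (hmemX G).1 hG
      obtain ⟨m, hm, hGm⟩ := hM'.exists_multiplexFace_of_rk_lt hG1 hG2 (by omega)
      exact ⟨m, not_le.1 fun h => hlate G hG m hm h hGm, hGm⟩

lemma sum_range_choose_min (d r e : ℕ) :
    ∑ q ∈ Finset.range (d + e), (min q d).choose r = d.choose (r + 1) + e * d.choose r := by
  induction e with
  | zero =>
    rw [zero_mul, add_zero, add_zero, ← sum_range_choose_eq]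
    exact Finset.sum_congr rfl fun q hq => by
      rw [min_eq_left (Finset.mem_range.1 hq).le]
  | succ e ih =>
    rw [← add_assoc, Finset.sum_range_succ, ih, min_eq_right (by omega)]
    ring

/-- The number of faces of rank `k` of a multiplex, obtained by sorting proper faces by the last
facet containing them. -/
lemma card_below : ∀ {d n : ℕ} {φ : ℕ → ι} {F : Finset ι},
    IsMultiplexFace S d n φ F → ∀ {k : ℕ}, k ≤ d →
      (S.below F k).card = (d + 1).choose k + (n - d) * (d - 1).choose (d - k)
  | 0, n, φ, F, hM, k, hk => by
    obtain rfl : k = 0 := by omega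
    rw [FaceSystem.below_zero, Finset.card_singleton, hM.params.2 (by omega)]
    simp
  | d + 1, n, φ, F, hM, k, hk => by
    rw [card_eq_sum_card_last _ (fun m G => G ⊆ multiplexFace φ (d + 1) n m) (n + 1) ?_]
    · have hterm : ∀ q ∈ Finset.range n, ((S.below F k).filter fun G =>
          G ⊆ multiplexFace φ (d + 1) n q ∧
            ∀ m' < n + 1, q < m' → ¬ G ⊆ multiplexFace φ (d + 1) n m').card =
          (min q d).choose (d + 1 - k) := by
        intro q hq
        rw [Finset.mem_range] at hq
        rw [← hM.card_last_facet hq hk]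
        congr 1
        ext G
        simp only [Finset.mem_filter, FaceSystem.mem_below, Nat.lt_succ_iff]
        exact ⟨fun h => ⟨⟨h.1.1, h.2.1, h.1.2.2⟩, h.2.2⟩,
          fun h => ⟨⟨h.1.1, h.1.2.1.trans (hM.multiplexFace_spec hq.le).2.1, h.1.2.2⟩,
            h.1.2.1, h.2⟩⟩
      have hlast : ((S.below F k).filter fun G => G ⊆ multiplexFace φ (d + 1) n n ∧
            ∀ m' < n + 1, n < m' → ¬ G ⊆ multiplexFace φ (d + 1) n m').card =
          (d + 1).choose k := by
        have heq : ((S.below F k).filter fun G => G ⊆ multiplexFace φ (d + 1) n n ∧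
            ∀ m' < n + 1, n < m' → ¬ G ⊆ multiplexFace φ (d + 1) n m') =
            S.below (multiplexFace φ (d + 1) n n) k := by
          ext G
          simp only [Finset.mem_filter, FaceSystem.mem_below]
          refine ⟨fun h => ⟨h.1.1, h.2.1, h.1.2.2⟩, fun h => ⟨⟨h.1, h.2.1.trans
            (hM.multiplexFace_spec le_rfl).2.1, h.2.2⟩, h.2.1, fun m' h1 h2 => by omega⟩⟩
        rw [heq]
        rcases hk.eq_or_lt with rfl | hk
        · have h := FaceSystem.below_rk_self (hM.multiplexFace_spec le_rfl).1
          rw [(hM.multiplexFace_spec le_rfl).2.2] at h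
          rw [h, Finset.card_singleton, Nat.choose_self]
        · have hsimplex : facetLast d n n = d := by simp [facetLast]
          rw [card_below (hM.facet le_rfl) (Nat.lt_succ_iff.1 hk), hsimplex, Nat.sub_self,
            zero_mul, add_zero]
      have hsum := congrArg₂ (· + ·) (Finset.sum_congr rfl hterm) hlast
      beta_reduce at hsum
      rw [Finset.sum_range_succ]
      trans ∑ x ∈ Finset.range n, (min x d).choose (d + 1 - k) + (d + 1).choose k
      · convert hsum
      obtain ⟨e, rfl⟩ : ∃ e, n = d + (e + 1) := ⟨n - d - 1, by have := hM.params.1; omega⟩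
      rw [sum_range_choose_min, show d + (e + 1) - (d + 1) = e by omega, Nat.add_sub_cancel]
      rcases Nat.eq_zero_or_pos k with rfl | hk0
      · simp [Nat.choose_eq_zero_of_lt]
      · obtain ⟨k, rfl⟩ := Nat.exists_eq_add_of_le' hk0
        have h1 : (d + 1).choose (d + 1 - k) = (d + 1).choose k := Nat.choose_symm (by omega)
        rw [show d + 1 - k = (d + 1 - (k + 1)) + 1 by omega, Nat.choose_succ_succ] at h1
        have h2 := Nat.choose_succ_succ (d + 1) k
        simp only [Nat.succ_eq_add_one] at h1 h2
        rw [h2, ← h1]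
        ring
    · intro G hG
      rw [FaceSystem.mem_below] at hG
      obtain ⟨i, hi, h⟩ := hM.exists_multiplexFace_of_rk_lt hG.1 hG.2.1 (by omega)
      exact ⟨i, by omega, h⟩

end IsMultiplexFace

end MultiplexCounts

/-! ### Duality and the total excess of the faces of a multiplex -/

section MultiplexDuality

open scoped Classical

variable {ι : Type*} {S : FaceSystem ι}

/-- Between a face `G` and a larger face `F` there is a face whose rank exceeds that of `G` by one. -/
lemma FaceSystem.exists_cover {F G : Finset ι} (hF : F ∈ S.faces) (hG : G ∈ S.faces)
    (hGF : G ⊂ F) : ∃ H ∈ S.faces, G ⊆ H ∧ H ⊆ F ∧ S.rk H = S.rk G + 1 := by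
  induction hr : S.rk F generalizing F with
  | zero => have := S.rk_lt hF hG hGF; omega
  | succ r ih =>
    have hlt := S.rk_lt hF hG hGF
    rcases (Nat.succ_le_of_lt hlt).eq_or_lt with h | h
    · exact ⟨F, hF, hGF.1, subset_rfl, h.symm⟩
    · obtain ⟨v, hv, hvG⟩ := Finset.exists_of_ssubset hGF
      obtain ⟨H, hH, hGH, hHF, -, hrk⟩ := S.exists_facet hF hG hGF.1 hv hvG
      obtain ⟨K, hK, h1, h2, h3⟩ := ih hH
        (FaceSystem.ssubset_of_rk_lt (S := S) hGH (by omega)) (by omega)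
      exact ⟨K, hK, h1, h2.trans hHF, h3⟩

/-- The duality of a multiplex: the vertices `φ i` whose index is that of a facet containing `G`. -/
noncomputable def multiplexDual (φ : ℕ → ι) (d n : ℕ) (G : Finset ι) : Finset ι :=
  ((Finset.range (n + 1)).filter fun i => G ⊆ multiplexFace φ d n i).image φ

namespace IsMultiplexFace

variable {d n : ℕ} {φ : ℕ → ι} {F G : Finset ι}

lemma mem_multiplexDual (hM : IsMultiplexFace S d n φ F) {i : ℕ} (hi : i ≤ n) :
    φ i ∈ multiplexDual φ d n G ↔ G ⊆ multiplexFace φ d n i := by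
  simp only [multiplexDual, Finset.mem_image, Finset.mem_filter, Finset.mem_range,
    Nat.lt_succ_iff]
  constructor
  · rintro ⟨j, ⟨hj, h⟩, he⟩
    exact hM.inj hj hi he ▸ h
  · exact fun h => ⟨i, ⟨hi, h⟩, rfl⟩

lemma multiplexDual_subset (hM : IsMultiplexFace S d n φ F) : multiplexDual φ d n G ⊆ F := by
  rw [hM.eq_image]
  exact Finset.image_subset_image (Finset.filter_subset _ _)

lemma inter_multiplexFaces_mem (hM : IsMultiplexFace S d n φ F) (U : Finset ℕ)
    (hU : ∀ v ∈ U, v ≤ n) : (F.filter fun w => ∀ v ∈ U, w ∈ multiplexFace φ d n v) ∈ S.faces := by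
  induction U using Finset.induction_on with
  | empty => simpa using hM.mem
  | insert u U _ ih =>
    have h := S.inter_mem (ih fun v hv => hU v (Finset.mem_insert_of_mem hv))
      (hM.multiplexFace_spec (hU u (Finset.mem_insert_self u U))).1
    convert h using 1
    ext w
    simp only [Finset.mem_filter, Finset.mem_insert, forall_eq_or_imp, Finset.mem_inter]
    tauto

lemma multiplexDual_mem (hM : IsMultiplexFace S d n φ F) (hGF : G ⊆ F) :
    multiplexDual φ d n G ∈ S.faces := by
  have h := hM.inter_multiplexFaces_mem
    ((Finset.range (n + 1)).filter fun v => φ v ∈ G) (by simp; omega)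
  convert h using 1
  ext w
  simp only [Finset.mem_filter, Finset.mem_range, Nat.lt_succ_iff]
  by_cases hw : w ∈ F
  · obtain ⟨i, hi, rfl⟩ := hM.mem_iff.1 hw
    rw [hM.mem_multiplexDual hi, and_iff_right hw]
    constructor
    · rintro h v ⟨hv, hvG⟩
      exact (hM.mem_multiplexFace hi).2 ((hM.mem_multiplexFace hv).1 (h hvG)).symm
    · intro h u hu
      obtain ⟨v, hv, rfl⟩ := hM.mem_iff.1 (hGF hu)
      exact (hM.mem_multiplexFace hv).2 ((hM.mem_multiplexFace hi).1 (h v ⟨hv, hu⟩)).symm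
  · exact iff_of_false (fun h => hw (hM.multiplexDual_subset h)) fun h => hw h.1

lemma multiplexDual_anti {H : Finset ι} (h : G ⊆ H) :
    multiplexDual φ d n H ⊆ multiplexDual φ d n G :=
  Finset.image_subset_image (Finset.monotone_filter_right _ fun _ _ h' => h.trans h')

/-- The duality is an involution, because a face is the intersection of the facets containing it. -/
lemma multiplexDual_multiplexDual (hM : IsMultiplexFace S d n φ F) (hG : G ∈ S.faces)
    (hGF : G ⊆ F) : multiplexDual φ d n (multiplexDual φ d n G) = G := by
  ext w
  by_cases hw : w ∈ F
  · obtain ⟨v, hv, rfl⟩ := hM.mem_iff.1 hw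
    rw [hM.mem_multiplexDual hv]
    constructor
    · intro h
      by_contra hvG
      obtain ⟨i, hi, hGi, hvi⟩ := hM.exists_multiplexFace hG hGF hw hvG
      have h1 := h ((hM.mem_multiplexDual hi).2 hGi)
      exact hvi ((hM.mem_multiplexFace hv).2 ((hM.mem_multiplexFace hi).1 h1).symm)
    · intro h u hu
      obtain ⟨i, hi, rfl⟩ := hM.mem_iff.1 (hM.multiplexDual_subset hu)
      have h1 := (hM.mem_multiplexDual hi).1 hu h
      exact (hM.mem_multiplexFace hi).2 ((hM.mem_multiplexFace hv).1 h1).symm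
  · exact iff_of_false (fun h => hw (hM.multiplexDual_subset h)) fun h => hw (hGF h)

lemma multiplexDual_ssubset (hM : IsMultiplexFace S d n φ F) {H : Finset ι} (hG : G ∈ S.faces)
    (hH : H ∈ S.faces) (hHF : H ⊆ F) (h : G ⊂ H) :
    multiplexDual φ d n H ⊂ multiplexDual φ d n G :=
  (multiplexDual_anti h.1).ssubset_of_ne fun he => h.ne (by
    rw [← hM.multiplexDual_multiplexDual hG (h.1.trans hHF), ← he,
      hM.multiplexDual_multiplexDual hH hHF])

/-- The duality reverses ranks: it reverses chains of faces, and every face lies on a chain in which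
the rank increases by one at each step. -/
lemma rk_multiplexDual (hM : IsMultiplexFace S d n φ F) (hG : G ∈ S.faces) (hGF : G ⊆ F) :
    S.rk G + S.rk (multiplexDual φ d n G) = d + 1 := by
  refine le_antisymm ?_ ?_
  · induction hr : S.rk G generalizing G with
    | zero =>
      rw [zero_add, ← hM.rk_eq]
      exact FaceSystem.rk_mono hM.mem (hM.multiplexDual_mem hGF) hM.multiplexDual_subset
    | succ r ih =>
      obtain ⟨v, hv⟩ := FaceSystem.nonempty_of_rk_pos (S := S) (F := G) (by omega)
      obtain ⟨H, hH, -, hHG, hvH, hrk⟩ := S.exists_facet hG S.empty_mem (Finset.empty_subset G) hv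
        (Finset.notMem_empty v)
      have h1 := ih hH (hHG.trans hGF) (by omega)
      have h2 := S.rk_lt (hM.multiplexDual_mem (hHG.trans hGF)) (hM.multiplexDual_mem hGF)
        (hM.multiplexDual_ssubset hH hG hGF (hHG.ssubset_of_ne fun h => hvH (h ▸ hv)))
      omega
  · induction hr : d + 1 - S.rk G generalizing G with
    | zero => omega
    | succ r ih =>
      have hss : G ⊂ F := FaceSystem.ssubset_of_rk_lt (S := S) hGF (by rw [hM.rk_eq]; omega)
      obtain ⟨H, hH, hGH, hHF, hrk⟩ := FaceSystem.exists_cover hM.mem hG hss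
      have h1 := ih hH hHF (by omega)
      have h2 := S.rk_lt (hM.multiplexDual_mem hGF) (hM.multiplexDual_mem hHF)
        (hM.multiplexDual_ssubset hG hH hHF
          (FaceSystem.ssubset_of_rk_lt (S := S) hGH (by omega)))
      omega

/-- By duality, the faces of rank `k` containing the vertex `φ v` correspond to the faces of
complementary rank in the facet `v`. -/
lemma card_below_filter_mem (hM : IsMultiplexFace S d n φ F) {v k : ℕ} (hv : v ≤ n)
    (hk : k ≤ d + 1) : ((S.below F k).filter fun G => φ v ∈ G).card =
      (S.below (multiplexFace φ d n v) (d + 1 - k)).card := by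
  have hvF := (hM.multiplexFace_spec hv).2.1
  refine Finset.card_nbij' (multiplexDual φ d n) (multiplexDual φ d n) ?_ ?_ ?_ ?_
  · intro G hG
    simp only [Finset.coe_filter, Set.mem_ofPred_eq, FaceSystem.mem_below] at hG
    obtain ⟨⟨hG, hGF, rfl⟩, hvG⟩ := hG
    have h := hM.rk_multiplexDual hG hGF
    refine Finset.mem_coe.2 (FaceSystem.mem_below.2 ⟨hM.multiplexDual_mem hGF, ?_, by omega⟩)
    rwa [← hM.mem_multiplexDual hv, hM.multiplexDual_multiplexDual hG hGF]
  · intro K hK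
    obtain ⟨hK, hKv, hrk⟩ := FaceSystem.mem_below.1 (Finset.mem_coe.1 hK)
    have h := hM.rk_multiplexDual hK (hKv.trans hvF)
    simp only [Finset.coe_filter, Set.mem_ofPred_eq, FaceSystem.mem_below]
    exact ⟨⟨hM.multiplexDual_mem (hKv.trans hvF), hM.multiplexDual_subset, by omega⟩,
      (hM.mem_multiplexDual hv).2 hKv⟩
  · intro G hG
    simp only [Finset.coe_filter, Set.mem_ofPred_eq, FaceSystem.mem_below] at hG
    exact hM.multiplexDual_multiplexDual hG.1.1 hG.1.2.1
  · intro K hK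
    obtain ⟨hK, hKv, -⟩ := FaceSystem.mem_below.1 (Finset.mem_coe.1 hK)
    exact hM.multiplexDual_multiplexDual hK (hKv.trans hvF)

lemma sum_card_below (hM : IsMultiplexFace S d n φ F) {k : ℕ} (hk : k ≤ d + 1) :
    ∑ G ∈ S.below F k, G.card =
      ∑ v ∈ Finset.range (n + 1), (S.below (multiplexFace φ d n v) (d + 1 - k)).card := by
  have h := Finset.sum_card_bipartiteAbove_eq_sum_card_bipartiteBelow (s := S.below F k)
    (t := Finset.range (n + 1)) (fun G v => φ v ∈ G)
  simp only [Finset.bipartiteAbove, Finset.bipartiteBelow] at h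
  have h1 : ∀ G ∈ S.below F k, ((Finset.range (n + 1)).filter fun v => φ v ∈ G).card = G.card := by
    intro G hG
    have hGF := (FaceSystem.mem_below.1 hG).2.1
    rw [← Finset.card_image_of_injOn (f := φ)]
    · congr 1
      ext w
      simp only [Finset.mem_image, Finset.mem_filter, Finset.mem_range, Nat.lt_succ_iff]
      constructor
      · rintro ⟨v, ⟨-, hv⟩, rfl⟩
        exact hv
      · intro hw
        obtain ⟨v, hv, rfl⟩ := hM.mem_iff.1 (hGF hw)
        exact ⟨v, ⟨hv, hw⟩, rfl⟩
    · intro a ha b hb he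
      simp only [Finset.coe_filter, Finset.mem_range, Set.mem_ofPred_eq, Nat.lt_succ_iff] at ha hb
      exact hM.inj ha.1 hb.1 he
  rw [← Finset.sum_congr rfl h1, h]
  exact Finset.sum_congr rfl fun v hv =>
    hM.card_below_filter_mem (Nat.lt_succ_iff.1 (Finset.mem_range.1 hv)) hk

end IsMultiplexFace

lemma two_mul_sum_range_min (D e : ℕ) :
    2 * ∑ q ∈ Finset.range (D + e + 1), min q D = D * (D + 1) + 2 * D * e := by
  induction e with
  | zero =>
    have h := Finset.sum_range_id_mul_two (D + 1)
    rw [Finset.sum_congr rfl fun q hq => min_eq_left (Nat.lt_succ_iff.1 (Finset.mem_range.1 hq))]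
    simp only [Nat.add_sub_cancel] at h
    rw [mul_comm 2]
    refine h.trans ?_
    ring
  | succ e ih =>
    rw [← add_assoc, Finset.sum_range_succ, mul_add, ih, min_eq_right (by omega)]
    ring

/-- The total excess of the facets of a `(D + 1)`-dimensional multiplex. -/
lemma sum_facetLast_sub {D n : ℕ} (h : MultiplexParams (D + 1) n) :
    ∑ q ∈ Finset.range (n + 1), (facetLast D n q - D) = (n - (D + 1)) * (D - 1) := by
  obtain ⟨e, rfl⟩ : ∃ e, n = D + 1 + e := ⟨n - (D + 1), by have := h.1; omega⟩
  have hterm : ∀ q ∈ Finset.range (D + 1 + e + 1), (facetLast D (D + 1 + e) q - D) + (D + 1) =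
      min q D + min (D + 1 + e - q) D +
        ((if q = 0 then 1 else 0) + (if q = D + 1 + e then 1 else 0)) := by
    intro q hq
    rw [Finset.mem_range] at hq
    unfold MultiplexParams facetLast at *
    split_ifs <;> omega
  have hsum := Finset.sum_congr rfl hterm
  simp only [Finset.sum_add_distrib, Finset.sum_const, Finset.card_range, smul_eq_mul, mul_one,
    Finset.sum_ite_eq', Finset.mem_range, Nat.succ_pos, Nat.lt_succ_self, if_true] at hsum
  have hrefl := Finset.sum_range_reflect (fun q => min q D) (D + 1 + e + 1)
  simp only [Nat.add_sub_cancel] at hrefl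
  rw [hrefl] at hsum
  have h2 := two_mul_sum_range_min D (e + 1)
  rw [show D + (e + 1) + 1 = D + 1 + e + 1 by omega] at h2
  have h3 : D = 0 → e = 0 := by have := h.2; omega
  rw [show D + 1 + e - (D + 1) = e by omega]
  rcases D with _ | D
  · obtain rfl := h3 rfl
    simp at hsum h2 ⊢
    omega
  · rw [Nat.add_sub_cancel]
    zify at *
    linarith

/-- The arithmetic behind the total excess of the faces of a multiplex of dimension `E + 2`. -/
lemma excess_identity (E e j : ℕ) :
    (E + 3 + e) * (E + 2).choose (j + 2) + E.choose (j + 1) * (e * E) =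
      (j + 3) * ((E + 3).choose (j + 3) + e * (E + 1).choose (j + 2)) + e * E.choose j := by
  have h1 := Nat.add_one_mul_choose_eq (E + 2) (j + 2)
  have h2 := Nat.add_one_mul_choose_eq E (j + 1)
  have h4 := Nat.choose_succ_succ (E + 1) (j + 1)
  have h5 := Nat.choose_succ_succ E j
  simp only [Nat.succ_eq_add_one, add_assoc, Nat.reduceAdd] at *
  zify at *
  linear_combination h1 + (e : ℤ) * (h4 + h5 + h2)

/-- Multiplexes have the face counts of iterated pyramids over polygons. For the total excess, the
incidences of vertices and faces are counted by `sum_card_below` as faces of the facets. -/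
theorem IsMultiplexFace.hasPyramidCounts {d n : ℕ} {φ : ℕ → ι}
    (hM : IsMultiplexFace S d n φ S.top) : S.HasPyramidCounts := by
  have cases : ∀ {F}, F ∈ S.faces → F = ∅ ∨ ∃ d' n' φ', IsMultiplexFace S d' n' φ' F := by
    intro F hF
    rcases F.eq_empty_or_nonempty with rfl | hne
    · exact Or.inl rfl
    · exact Or.inr (hM.exists_isMultiplexFace hF (S.subset_top hF) hne)
  refine ⟨fun {F} hF => ?_, fun {F} hF k => ?_, fun {F} hF k => ?_⟩
  · rcases cases hF with rfl | ⟨d, n, φ, hM⟩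
    · simp [S.rk_empty]
    · rw [hM.card_eq, hM.rk_eq]
      have := hM.params
      unfold MultiplexParams at this
      omega
  · rcases cases hF with rfl | ⟨d, n, φ, hM⟩
    · rw [FaceSystem.below_eq_empty hF (by rw [S.rk_empty]; omega)]
      simp [S.rk_empty]
    · rw [hM.card_eq, hM.rk_eq, Nat.add_sub_add_right, show d + 1 - 2 = d - 1 by omega]
      rcases lt_trichotomy k d with h | rfl | h
      · rw [hM.card_below h, ← Nat.choose_symm (show k ≤ d - 1 by omega),
          show d - 1 - k = d - (k + 1) by omega]
      · have h1 := FaceSystem.below_rk_self hF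
        rw [hM.rk_eq] at h1
        rw [h1, Finset.card_singleton, Nat.choose_self]
        rcases Nat.eq_zero_or_pos k with rfl | hk
        · rw [hM.params.2 (by omega)]; simp
        · rw [Nat.choose_eq_zero_of_lt (by omega), mul_zero, add_zero]
      · rw [FaceSystem.below_eq_empty hF (by rw [hM.rk_eq]; omega), Finset.card_empty,
          Nat.choose_eq_zero_of_lt (by omega), Nat.choose_eq_zero_of_lt (by omega), mul_zero,
          add_zero]
  · rcases cases hF with rfl | ⟨d, n, φ, hM⟩
    · rw [FaceSystem.below_eq_empty hF (by rw [S.rk_empty]; omega)]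
      simp [S.rk_empty]
    · rw [hM.card_eq, hM.rk_eq, Nat.add_sub_add_right]
      rcases lt_trichotomy (k + 3) (d + 1) with h | h | h
      · obtain ⟨E, rfl⟩ : ∃ E, d = E + 2 := ⟨d - 2, by omega⟩
        obtain ⟨e, rfl⟩ : ∃ e, n = E + 2 + e := ⟨n - (E + 2), by have := hM.params.1; omega⟩
        have hcard := hM.card_below (k := k + 3) (by omega)
        have hsub : ∑ G ∈ S.below F (k + 3), (G.card - (k + 3)) +
            (S.below F (k + 3)).card * (k + 3) = ∑ G ∈ S.below F (k + 3), G.card := by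
          rw [← smul_eq_mul, ← Finset.sum_const, ← Finset.sum_add_distrib]
          refine Finset.sum_congr rfl fun G hG => ?_
          have := S.rk_le_card G
          rw [(FaceSystem.mem_below.1 hG).2.2] at this
          omega
        have hfac : ∀ v ∈ Finset.range (E + 2 + e + 1),
            (S.below (multiplexFace φ (E + 2) (E + 2 + e) v) (E + 2 + 1 - (k + 3))).card =
            (E + 2).choose (k + 2) +
              (facetLast (E + 1) (E + 2 + e) v - (E + 1)) * E.choose (k + 1) := by
          intro v hv
          rw [Finset.mem_range, Nat.lt_succ_iff] at hv
          rw [show E + 2 + 1 - (k + 3) = E + 1 + 1 - (k + 2) by omega,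
            (hM.facet hv).card_below (by omega), Nat.choose_symm (by omega), Nat.add_sub_cancel,
            show E + 1 - (E + 1 + 1 - (k + 2)) = k + 1 by omega]
        rw [hM.sum_card_below (by omega), Finset.sum_congr rfl hfac, Finset.sum_add_distrib,
          ← Finset.sum_mul, sum_facetLast_sub hM.params, Finset.sum_const, Finset.card_range,
          smul_eq_mul, hcard, show E + 2 + e - (E + 1 + 1) = e by omega,
          Nat.add_sub_cancel, show E + 2 - 1 = E + 1 by omega,
          show (E + 1).choose (E + 2 - (k + 3)) = (E + 1).choose (k + 2) by
            rw [← Nat.choose_symm (show k + 2 ≤ E + 1 by omega)]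
            congr 1
            omega] at hsub
        have hid := excess_identity E e k
        rw [show E + 2 + e - (E + 2) = e by omega, show E + 2 + 1 - 3 = E by omega]
        zify at *
        linarith
      · have h1 := FaceSystem.below_rk_self hF
        rw [hM.rk_eq, ← h] at h1
        rw [h1, Finset.sum_singleton, hM.card_eq, ← h, Nat.add_sub_cancel, Nat.choose_self]
        omega
      · rw [FaceSystem.below_eq_empty hF (by rw [hM.rk_eq]; omega), Finset.sum_empty]
        rcases Nat.lt_or_ge d 2 with hd | hd
        · rw [hM.params.2 (by omega), Nat.sub_self, zero_mul]
        · rw [Nat.choose_eq_zero_of_lt (by omega), mul_zero]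

end MultiplexDuality

/-! ### Multiplexes as polytopes -/

section MultiplexVertices

open scoped Classical

variable {E : Type*}

/-- The vertices of a multiplex, indexed by all natural numbers. -/
def multiplexVertex {n : ℕ} (x : Fin (n + 1) → E) (m : ℕ) : E := x (clampIndex n m)

lemma multiplexVertex_coe {n : ℕ} (x : Fin (n + 1) → E) (i : Fin (n + 1)) :
    multiplexVertex x i = x i := by
  unfold multiplexVertex clampIndex
  congr 1
  ext
  have := i.2
  simp only
  omega

lemma multiplexVertex_injOn {n : ℕ} {x : Fin (n + 1) → E} (hx : Function.Injective x) :
    Set.InjOn (multiplexVertex x) (Set.Iic n) := by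
  intro a ha b hb h
  have h1 := congrArg Fin.val (hx h)
  simp only [clampIndex, Set.mem_Iic] at *
  omega

lemma image_range_multiplexVertex {n : ℕ} (x : Fin (n + 1) → E) :
    (((Finset.range (n + 1)).image (multiplexVertex x) : Finset E) : Set E) = Set.range x := by
  ext w
  simp only [Finset.coe_image, Finset.coe_range, Set.mem_image, Set.mem_Iio, Set.mem_range]
  constructor
  · rintro ⟨m, -, rfl⟩
    exact ⟨_, rfl⟩
  · rintro ⟨i, rfl⟩
    exact ⟨i, i.2, multiplexVertex_coe x i⟩

end MultiplexVertices

section MultiplexPolytopes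

open scoped Classical

variable {E : Type*} [NormedAddCommGroup E] [NormedSpace ℝ E]

/-- The vertex lists of the facets agree with the incidence relation `MultiplexInc`; the clamped
indices account for the exceptional incidences of the first and the last vertex. -/
lemma multiplexFacet_eq {d n : ℕ} (hd : 2 ≤ d) (x : Fin (n + 1) → E)
    (i : Fin (n + 1)) : multiplexFacet d x i =
      convexHull ℝ (multiplexFace (multiplexVertex x) d n i : Set E) := by
  rw [multiplexFacet]
  congr 1
  have hi := i.2
  ext w
  simp only [multiplexFace, Finset.coe_image, Set.mem_image, Finset.mem_coe, mem_multiplexVerts,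
    Set.mem_ofPred_eq]
  constructor
  · rintro ⟨j, hj, rfl⟩
    refine ⟨(clampIndex n j : ℕ), ?_, multiplexVertex_coe x _⟩
    simp only [clampIndex, MultiplexInc]
    omega
  · rintro ⟨v, ⟨hv, hvi⟩, rfl⟩
    unfold MultiplexInc at hvi
    refine ⟨if v = i then (if v = 0 then -1 else n + 1) else v, ?_, ?_⟩
    · split_ifs <;> omega
    · unfold multiplexVertex clampIndex
      congr 2
      split_ifs <;> omega

lemma IsVertexFace.eq_of_convexHull_eq {V F A : Finset E}
    (hV : ∀ v ∈ V, v ∈ (convexHull ℝ (V : Set E)).extremePoints ℝ) (hF : IsVertexFace V F)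
    (hA : A ⊆ V) (h : convexHull ℝ (F : Set E) = convexHull ℝ (A : Set E)) : F = A := by
  refine Finset.Subset.antisymm (fun v hv => ?_) fun v hv =>
    hF.mem_of_mem_convexHull (hA hv) (h.ge (subset_convexHull ℝ _ hv))
  have h1 : v ∈ convexHull ℝ (A : Set E) := h.le (subset_convexHull ℝ _ hv)
  exact extremePoints_convexHull_subset (inter_extremePoints_subset_extremePoints_of_subset
    (convexHull_mono (Finset.coe_subset.2 hA)) ⟨h1, hV v (hF.1 hv)⟩)

lemma IsMultiplex.isMultiplexFace [FiniteDimensional ℝ E] {d n : ℕ} (hd : 2 ≤ d) (hn : d ≤ n)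
    {x : Fin (n + 1) → E} {P : Set E} (hP : IsMultiplex d x P) :
    ∃ V : Finset E, P = convexHull ℝ (V : Set E) ∧ vertexRank V = d + 1 ∧
      IsMultiplexFace (polytopeFaces V) d n (multiplexVertex x) V := by
  obtain ⟨V, hV⟩ : ∃ V, V = (Finset.range (n + 1)).image (multiplexVertex x) := ⟨_, rfl⟩
  have hrange : (V : Set E) = Set.range x := hV ▸ image_range_multiplexVertex x
  have hPV : P = convexHull ℝ (V : Set E) := by rw [hP.eq_convexHull, hrange]
  subst hPV
  have hext : ∀ v ∈ V, v ∈ (convexHull ℝ (V : Set E)).extremePoints ℝ := fun v hv => by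
    rw [hP.vertices, ← hrange]; exact hv
  have hne : V.Nonempty := by rw [hV]; simp
  have hrk : vertexRank V = d + 1 := by rw [vertexRank_eq_convexDim hne, hP.dim]
  have hsub : ∀ i, multiplexFace (multiplexVertex x) d n i ⊆ V := fun i => by
    rw [hV]; exact Finset.image_subset_image (Finset.filter_subset _ _)
  refine ⟨V, rfl, hrk, ⟨hn, by omega⟩, multiplexVertex_injOn hP.injective, hV,
    (polytopeFaces V).top_mem, hrk, fun H => ⟨?_, ?_⟩⟩
  · rintro ⟨hH, hHV, hHd⟩
    rw [mem_polytopeFaces] at hH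
    rw [polytopeFaces_rk] at hHd
    have hHne : H.Nonempty := by
      by_contra h
      rw [Finset.not_nonempty_iff_eq_empty.1 h, vertexRank_empty] at hHd
      omega
    have hfacet : IsFacet (convexHull ℝ (V : Set E)) (convexHull ℝ (H : Set E)) := by
      refine ⟨isProperFace_convexHull_iff.2 ⟨H, ⟨hH, hHne, hHV.ssubset_of_ne fun h => ?_⟩, rfl⟩,
        ?_⟩
      · rw [h] at hHd; omega
      · rw [← vertexRank_eq_convexDim hHne, hP.dim, hHd]
    obtain ⟨i, hi⟩ := hP.facets.le hfacet
    rw [multiplexFacet_eq hd] at hi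
    exact ⟨i, Nat.lt_succ_iff.1 i.2, hH.eq_of_convexHull_eq hext (hsub i) hi.symm⟩
  · rintro ⟨i, hi, rfl⟩
    have hfacet : IsFacet (convexHull ℝ (V : Set E))
        (multiplexFacet d x ⟨i, Nat.lt_succ_iff.2 hi⟩) := hP.facets.ge ⟨_, rfl⟩
    obtain ⟨hproper, hdim⟩ := hfacet
    obtain ⟨H, ⟨hH, hHne, -⟩, he⟩ := isProperFace_convexHull_iff.1 hproper
    have hdim' := he ▸ hdim
    rw [multiplexFacet_eq hd] at he
    obtain rfl := hH.eq_of_convexHull_eq hext (hsub i) he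
    rw [hP.dim, ← vertexRank_eq_convexDim hHne] at hdim'
    exact ⟨mem_polytopeFaces.2 hH, hH.1, hdim'⟩

lemma flagVector_eq_flagFormula [FiniteDimensional ℝ E] {d n r : ℕ} {V : Finset E}
    (hV : (polytopeFaces V).HasPyramidCounts) (hrk : vertexRank V = d + 1)
    (hcard : V.card = n + 1) (s : Fin r → Fin d) (hs : StrictMono s) :
    (flagVector d (convexHull ℝ (V : Set E)) (Finset.univ.image s) : ℚ) = flagFormula d n s := by
  rw [← hV.card_flagsBelow (polytopeFaces V).top_mem hrk hcard s hs, flagVector_convexHull,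
    Finset.image_image]
  rfl

lemma IsMultiplex.flagVector_eq [FiniteDimensional ℝ E] {d n r : ℕ} (hd : 2 ≤ d) (hn : d ≤ n)
    {x : Fin (n + 1) → E} {P : Set E} (hP : IsMultiplex d x P) (s : Fin r → Fin d)
    (hs : StrictMono s) :
    (flagVector d P (Finset.univ.image s) : ℚ) = flagFormula d n s := by
  obtain ⟨V, rfl, hrk, hM⟩ := hP.isMultiplexFace hd hn
  exact flagVector_eq_flagFormula (hM.hasPyramidCounts (S := polytopeFaces V)) hrk hM.card_eq s hs

lemma IsIteratedPyramid.flagVector_eq [FiniteDimensional ℝ E] {d n r : ℕ} (hd : 2 ≤ d)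
    (hn : d ≤ n) {G Q : Set E} (hG : IsPolygon (n - d + 3) G)
    (hQ : IsIteratedPyramid G (d - 2) Q) (s : Fin r → Fin d) (hs : StrictMono s) :
    (flagVector d Q (Finset.univ.image s) : ℚ) = flagFormula d n s := by
  obtain ⟨V, rfl, hcard, hrk, hV⟩ := hQ.exists_polytopeFaces hG
  exact flagVector_eq_flagFormula hV (by omega) (by omega) s hs

end MultiplexPolytopes

theorem mainTheorem1
    {E : Type*} [NormedAddCommGroup E] [NormedSpace ℝ E] [FiniteDimensional ℝ E]
    {E' : Type*} [NormedAddCommGroup E'] [NormedSpace ℝ E'] [FiniteDimensional ℝ E']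
    (d n : ℕ) (hd : 2 ≤ d) (hn : d ≤ n) :
    (∀ (x : Fin (n + 1) → E) (P : Set E) (G Q : Set E'),
      IsMultiplex d x P → IsPolygon (n - d + 3) G → IsIteratedPyramid G (d - 2) Q →
        flagVector d P = flagVector d Q) ∧
    (∀ (x : Fin (n + 1) → E) (P : Set E), IsMultiplex d x P →
      ∀ (r : ℕ) (s : Fin r → Fin d), StrictMono s →
        (flagVector d P (Finset.univ.image s) : ℚ) = flagFormula d n s) ∧
    (∀ (G Q : Set E'), IsPolygon (n - d + 3) G → IsIteratedPyramid G (d - 2) Q →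
      ∀ (r : ℕ) (s : Fin r → Fin d), StrictMono s →
        (flagVector d Q (Finset.univ.image s) : ℚ) = flagFormula d n s) := by
  refine ⟨fun x P G Q hP hG hQ => funext fun T => ?_, fun x P hP r s hs =>
    hP.flagVector_eq hd hn s hs, fun G Q hG hQ r s hs => hQ.flagVector_eq hd hn hG s hs⟩
  have hT : Finset.univ.image (T.orderEmbOfFin rfl) = T := Finset.image_orderEmbOfFin_univ T rfl
  have h1 := hP.flagVector_eq hd hn _ (T.orderEmbOfFin rfl).strictMono
  have h2 := hQ.flagVector_eq hd hn hG _ (T.orderEmbOfFin rfl).strictMono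
  rw [hT] at h1 h2
  exact_mod_cast h1.trans h2.symm
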